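/- Let $\overline M$ be a smooth manifold with boundary of dimension $n\ge 2$, with boundary inclusion $i:\partial M\hookrightarrow\overline M$, endowed with a projective structure $[\nabla]$, i.e. a class of smooth torsion-free affine connections modulo $\hat\nabla_XY=\nabla_XY+\Upsilon(X)Y+\Upsilon(Y)X$, $\Upsilon$ a smooth $1$-form. A boundary chart has coordinates $x^0=r\ge 0$, $x^\mu=y^\mu$ ($1\le\mu\le n-1$), with $\partial M=\{r=0\}$ on its domain; the local connection forms of a connection $\nabla$ in it are defined by $\nabla\frac{\partial}{\partial x^j}=\alpha^i_j\otimes\frac{\partial}{\partial x^i}$. Assume the non-rigidity condition: at every boundary point, in some boundary chart and for some connection in the class, $\alpha^0_\mu\in\mathrm{span}(\mathrm dr)$ for all $1\le\mu\le n-1$. Fix a connection in $[\nabla]$ with local connection forms $\alpha^i_j$, Ricci tensor $R_{ab}$ (where $R_{ab}=R_{ca}{}^c{}_b$ and $(\nabla_a\nabla_b-\nabla_b\nabla_a)X^c=R_{ab}{}^c{}_dX^d$), and projective Schouten tensor $P_{ab}$ given by $(n-1)P_{ab}=R_{ab}-\frac{2}{n+1}R_{[ab]}$. Let $\{U_i\}$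 be a cover of $\partial M$ by (domains of) boundary charts of $\overline M$, and on each $U=U_i$ consider the local gauge of the normal projective Cartan connection $$\omega_{U}=\begin{pmatrix}\alpha^0_0-\frac1{n+1}\alpha^l_l&\alpha^0_\nu&\mathrm dr\\ \alpha^\mu_0&\alpha^\mu_\nu-\frac1{n+1}\alpha^l_l\delta^\mu_\nu&\mathrm dy^\mu\\-P_{j0}\mathrm dx^j&-P_{j\nu}\mathrm dx^j&-\frac1{n+1}\alpha^l_l\end{pmatrix}.$$ Let $\tilde{\mathfrak g}$ be the Lie algebra of the stabiliser $\tilde G\subset PGL(n,\mathbb R)=GL(n+1,\mathbb R)/\mathbb R^*$ of the hyperplane $\mathcal H=\{X_0=0\}\cong\mathbb{RP}^{n-1}$ of $\mathbb{RP}^n$, and $\mathfrak k$ the Lie algebra of the kernel $K=\left\{\begin{pmatrix}a&0\\b&\lambda I_n\end{pmatrix}\right\}$ of the action of $\tilde G$ on $\mathcal H$, so that $\tilde{\mathfrak g}/\mathfrak k\cong\mathfrak{gl}(n,\mathbb R)/\mathbb R I_n=:\mathfrak g'$, the Lie algebra of $G'=GL(n,\mathbb R)/\mathbb R^*$. Let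 $H'\subset G'$, with Lie algebra $\mathfrak h'$, be the isotropy group of the point $[0:\dots:0:1]$ of $\mathbb{RP}^{n-1}=G'/H'$. Then $i^*\omega_{U_i}$ takes values in $\tilde{\mathfrak g}$ for each $i$, and, with $\tilde\omega_i=i^*\omega_{U_i}\bmod\mathfrak k$, the collection $\{U_i\cap\partial M,\tilde\omega_i\}$ is a Cartan atlas on $\partial M$ modelled on the projective space $\mathbb{RP}^{n-1}=G'/H'$. That is: each $\tilde\omega_i$ is a smooth $\mathfrak g'$-valued $1$-form inducing isomorphisms $T_x\partial M\to\mathfrak g'/\mathfrak h'$, the sets $U_i\cap\partial M$ are open and cover $\partial M$, and any two gauges are compatible, meaning that there are smooth maps $\tilde h_{ij}:U_i\cap U_j\cap\partial M\to H'$ with $$\tilde\omega_j=\tilde h_{ij}^*\omega_{H'}+\mathrm{Ad}_{\tilde h_{ij}^{-1}}\tilde\omega_i ,$$ where $\omega_{H'}$ is the Maurer–Cartan form. The maps $\tilde h_{ij}$ can be chosen to satisfy the cocycle condition $\tilde h_{ik}=\tilde h_{ij}\tilde h_{jk}$ on triple overlaps, and the atlas is contained in exactly one maximal Cartan atlas,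 i.e. it defines an $(n-1)$-dimensional projective Cartan geometry on $\partial M$. -/

import Mathlib

open Set Topology Bundle
open scoped Manifold ContDiff MatrixGroups LinearAlgebra.Projectivization

attribute [local instance 100] LieRing.ofAssociativeRing

noncomputable section

/-! ### The boundary of a smooth manifold with boundary, as a smooth manifold

Throughout, `M` is a manifold with boundary of dimension `m + 1`. The model `𝓡∂ (m + 1)` is the
half-space `{x | 0 ≤ x 0}`, so the coordinate `x 0` of a chart is the boundary defining function `r`
and `x μ.succ`, `μ : Fin m`, are the coordinates `y`. -/

/-- The boundary `∂M`, as a subtype of `M`. -/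
abbrev Bdry (m : ℕ) (M : Type*) [TopologicalSpace M]
    [ChartedSpace (EuclideanHalfSpace (m + 1)) M] : Type _ :=
  ((𝓡∂ (m + 1)).boundary M : Set M)

/-- The inclusion `y ↦ (0, y)` of `ℝ^m` as the boundary hyperplane of the half-space. -/
def zeroCons {m : ℕ} (y : EuclideanSpace ℝ (Fin m)) : EuclideanHalfSpace (m + 1) :=
  ⟨WithLp.toLp 2 (Fin.cons 0 y), by simp⟩

/-- The tangential coordinates `(r, y) ↦ y`. -/
def tailCoord {m : ℕ} (x : EuclideanHalfSpace (m + 1)) : EuclideanSpace ℝ (Fin m) :=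
  WithLp.toLp 2 (fun μ => x.val μ.succ)

theorem tailCoord_zeroCons {m : ℕ} (y : EuclideanSpace ℝ (Fin m)) :
    tailCoord (zeroCons y) = y := by
  ext μ; simp [tailCoord, zeroCons]

theorem zeroCons_tailCoord {m : ℕ} (x : EuclideanHalfSpace (m + 1)) (hx : x.val 0 = 0) :
    zeroCons (tailCoord x) = x := by
  apply EuclideanHalfSpace.ext
  ext i
  refine Fin.cases ?_ (fun μ => ?_) i
  · simp [zeroCons, hx]
  · simp [tailCoord, zeroCons]

theorem contDiff_zeroCons_val {m : ℕ} :
    ContDiff ℝ ∞ (fun y : EuclideanSpace ℝ (Fin m) => (zeroCons y).val) := by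
  rw [contDiff_euclidean]
  intro i
  refine Fin.cases ?_ (fun μ => ?_) i
  · simpa [zeroCons] using contDiff_const
  · have : ContDiff ℝ ∞ (fun y : EuclideanSpace ℝ (Fin m) => y μ) := by fun_prop
    simpa [zeroCons] using this

theorem continuous_zeroCons {m : ℕ} : Continuous (zeroCons (m := m)) :=
  Continuous.subtype_mk contDiff_zeroCons_val.continuous _

theorem continuous_tailCoord {m : ℕ} : Continuous (tailCoord (m := m)) := by
  refine (PiLp.continuous_toLp 2 _).comp (continuous_pi fun μ => ?_)
  exact (PiLp.continuous_apply 2 _ μ.succ).comp continuous_subtype_val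

section Boundary

variable {m : ℕ} {M : Type*} [TopologicalSpace M] [ChartedSpace (EuclideanHalfSpace (m + 1)) M]
  [IsManifold (𝓡∂ (m + 1)) ∞ M]

/-- In every chart of the atlas the boundary is `{r = 0}`. -/
theorem mem_boundary_iff_of_mem_atlas {e : OpenPartialHomeomorph M (EuclideanHalfSpace (m + 1))}
    (he : e ∈ atlas (EuclideanHalfSpace (m + 1)) M) {x : M} (hx : x ∈ e.source) :
    x ∈ (𝓡∂ (m + 1)).boundary M ↔ (e x).val 0 = 0 := by
  have h := (𝓡∂ (m + 1)).isInteriorPoint_iff_of_mem_atlas (M := M) (n := ∞) (by simp) he hx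
  have h2 : e.extend (𝓡∂ (m + 1)) x ∈ interior (e.extend (𝓡∂ (m + 1))).target ↔
      0 < (e x).val 0 := by
    have h3 : 0 < (e x).val 0 ↔ (𝓡∂ (m + 1)) (e x) ∈ interior (range (𝓡∂ (m + 1))) := by
      rw [interior_range_modelWithCornersEuclideanHalfSpace]; rfl
    rw [h3]
    exact ⟨fun h => e.interior_extend_target_subset_interior_range h,
      fun h => e.mem_interior_extend_target (e.map_source hx) h⟩
  have h4 : x ∈ (𝓡∂ (m + 1)).boundary M ↔ ¬ (𝓡∂ (m + 1)).IsInteriorPoint x :=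
    (𝓡∂ (m + 1)).isBoundaryPoint_iff_not_isInteriorPoint x
  rw [h4, h, h2, not_lt]
  exact ⟨fun h => le_antisymm h (e x).property, fun h => h.le⟩

open scoped Classical in
/-- The chart `y` of `∂M` obtained by restricting a chart `(r, y)` of `M`. The point `p` is only
used as the value of the inverse map off its target. -/
def boundaryChart (e : OpenPartialHomeomorph M (EuclideanHalfSpace (m + 1)))
    (he : e ∈ atlas (EuclideanHalfSpace (m + 1)) M) (p : Bdry m M) :
    OpenPartialHomeomorph (Bdry m M) (EuclideanSpace ℝ (Fin m)) where
  toFun x := tailCoord (e x.val)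
  invFun y :=
    if h : zeroCons y ∈ e.target then
      ⟨e.symm (zeroCons y), (mem_boundary_iff_of_mem_atlas he (e.map_target h)).2 (by
        rw [e.right_inv h]; simp [zeroCons])⟩
    else p
  source := {x | x.val ∈ e.source}
  target := {y | zeroCons y ∈ e.target}
  map_source' x hx := by
    have h0 := (mem_boundary_iff_of_mem_atlas he hx).1 x.property
    simp only [mem_ofPred_eq, zeroCons_tailCoord _ h0]
    exact e.map_source hx
  map_target' y hy := by
    simp only [mem_ofPred_eq] at hy
    simp only [hy, dif_pos, mem_ofPred_eq]
    exact e.map_target hy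
  left_inv' x hx := by
    have h0 := (mem_boundary_iff_of_mem_atlas he hx).1 x.property
    have h1 : e x.val ∈ e.target := e.map_source hx
    apply Subtype.ext
    simp only [zeroCons_tailCoord _ h0, h1, dif_pos]
    exact e.left_inv hx
  right_inv' y hy := by
    simp only [mem_ofPred_eq] at hy
    simp only [hy, dif_pos, e.right_inv hy, tailCoord_zeroCons]
  open_source := e.open_source.preimage continuous_subtype_val
  open_target := e.open_target.preimage continuous_zeroCons
  continuousOn_toFun :=
    continuous_tailCoord.comp_continuousOn
      (e.continuousOn.comp continuous_subtype_val.continuousOn fun _ hx => hx)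
  continuousOn_invFun := by
    rw [Topology.IsInducing.subtypeVal.continuousOn_iff]
    refine (e.continuousOn_symm.comp continuous_zeroCons.continuousOn fun _ hy => hy).congr ?_
    intro y hy
    have hy' : zeroCons y ∈ e.target := hy
    simp only [Function.comp_apply, hy', dif_pos]

theorem boundaryChart_symm_val (e : OpenPartialHomeomorph M (EuclideanHalfSpace (m + 1)))
    (he : e ∈ atlas (EuclideanHalfSpace (m + 1)) M) (p : Bdry m M)
    {y : EuclideanSpace ℝ (Fin m)} (h : zeroCons y ∈ e.target) :
    ((boundaryChart e he p).symm y).val = e.symm (zeroCons y) := by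
  classical
  exact congrArg Subtype.val (dif_pos h)

/-- The atlas of `∂M`: all restrictions of charts of the atlas of `M`. -/
instance boundaryChartedSpace : ChartedSpace (EuclideanSpace ℝ (Fin m)) (Bdry m M) where
  atlas := {c | ∃ e he p, c = boundaryChart e he p}
  chartAt x := boundaryChart (chartAt _ x.val) (chart_mem_atlas _ x.val) x
  mem_chart_source x := mem_chart_source _ x.val
  chart_mem_atlas _ := ⟨_, _, _, rfl⟩

instance boundaryIsManifold : IsManifold (𝓡 m) ∞ (Bdry m M) := by
  refine isManifold_of_contDiffOn (𝓡 m) ∞ (Bdry m M) ?_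
  rintro _ _ ⟨e, he, p, rfl⟩ ⟨e', he', p', rfl⟩
  have key := (𝓡∂ (m + 1)).contDiffOn_extendCoordChange (n := ∞)
    (IsManifold.subset_maximalAtlas (n := ∞) he) (IsManifold.subset_maximalAtlas (n := ∞) he')
  have htail : ContDiff ℝ ∞ (fun x : EuclideanSpace ℝ (Fin (m + 1)) =>
      (WithLp.toLp 2 (fun μ : Fin m => x μ.succ) : EuclideanSpace ℝ (Fin m))) := by
    rw [contDiff_euclidean]
    intro μ
    have : ContDiff ℝ ∞ (fun x : EuclideanSpace ℝ (Fin (m + 1)) => x μ.succ) := by fun_prop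
    simpa using this
  have hI : ∀ y : EuclideanSpace ℝ (Fin m),
      (𝓡∂ (m + 1)).symm (zeroCons y).val = zeroCons y :=
    fun y => (𝓡∂ (m + 1)).left_inv (zeroCons y)
  refine (htail.comp_contDiffOn (key.comp contDiff_zeroCons_val.contDiffOn ?_)).congr ?_
  · rintro y ⟨hy, -⟩
    have h1 : zeroCons y ∈ e.target := hy.1
    have h2 : e.symm (zeroCons y) ∈ e'.source := by
      rw [← boundaryChart_symm_val e he p h1]; exact hy.2
    have h3 := (𝓡∂ (m + 1)).extendCoordChange_source (e := e) (e' := e')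
    exact h3 ▸ ⟨zeroCons y, ⟨h1, h2⟩, rfl⟩
  · rintro y ⟨hy, -⟩
    have h1 : zeroCons y ∈ e.target := hy.1
    change tailCoord (e' ((boundaryChart e he p).symm y).val) =
      tailCoord (e' (e.symm ((𝓡∂ (m + 1)).symm (zeroCons y).val)))
    rw [boundaryChart_symm_val e he p h1, hI]

end Boundary

/-! ### The homogeneous model

Homogeneous coordinates on `ℝP^(m+1)` are indexed by `Fin (m + 1) ⊕ Unit`: the indices `inl i`
are `0, …, m`, and `inr ()` is the last one. The hyperplane `X₀ = 0` is an `ℝP^m`, with homogeneous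
coordinates indexed by `Fin m ⊕ Unit`. -/

/-- Homogeneous coordinates on `ℝP^m`. -/
abbrev HIdx (m : ℕ) : Type := Fin m ⊕ Unit

/-- The scalar matrices, as an ideal of `𝔤𝔩(ι)`. -/
def scalarIdeal (ι : Type) [Fintype ι] [DecidableEq ι] : LieIdeal ℝ (Matrix ι ι ℝ) where
  carrier := {X | ∃ c : ℝ, X = c • (1 : Matrix ι ι ℝ)}
  add_mem' := by
    rintro _ _ ⟨a, rfl⟩ ⟨b, rfl⟩
    exact ⟨a + b, (add_smul _ _ _).symm⟩
  zero_mem' := ⟨0, by simp⟩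
  smul_mem' := by
    rintro c _ ⟨a, rfl⟩
    exact ⟨c * a, smul_smul _ _ _⟩
  lie_mem := by
    rintro x _ ⟨a, rfl⟩
    exact ⟨0, by simp [Ring.lie_def]⟩

/-- `𝔭𝔤𝔩(ι) = 𝔤𝔩(ι) / scalars`, the Lie algebra of `PGL(ι, ℝ)`. -/
abbrev Pgl (ι : Type) [Fintype ι] [DecidableEq ι] : Type :=
  Matrix ι ι ℝ ⧸ scalarIdeal ι

/-- The class of a matrix in `𝔭𝔤𝔩(ι)`. -/
def Pgl.mk {ι : Type} [Fintype ι] [DecidableEq ι] : Matrix ι ι ℝ →ₗ[ℝ] Pgl ι :=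
  (scalarIdeal ι).toSubmodule.mkQ

/-- The adjoint action of `GL(ι)` on `𝔤𝔩(ι)`, `X ↦ g X g⁻¹`. -/
def conjGL {ι : Type} [Fintype ι] [DecidableEq ι] (g : GL ι ℝ) :
    Matrix ι ι ℝ →ₗ[ℝ] Matrix ι ι ℝ where
  toFun X := g.val * X * g⁻¹.val
  map_add' X Y := by rw [mul_add, add_mul]
  map_smul' c X := by simp

/-- The adjoint action of `GL(ι)` on `𝔭𝔤𝔩(ι)`. -/
def adGL (ι : Type) [Fintype ι] [DecidableEq ι] : GL ι ℝ →* Module.End ℝ (Pgl ι) where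
  toFun g := Submodule.mapQ _ _ (conjGL g) (by
    rintro _ ⟨c, rfl⟩
    exact ⟨c, by simp [conjGL]⟩)
  map_one' := by
    refine Submodule.linearMap_qext _ (LinearMap.ext fun X => ?_)
    simp [conjGL]
  map_mul' g h := by
    refine Submodule.linearMap_qext _ (LinearMap.ext fun X => ?_)
    simp [conjGL, mul_assoc]

/-- The adjoint action of `PGL(ι, ℝ)` on its Lie algebra `𝔭𝔤𝔩(ι)`. -/
def adPGL (ι : Type) [Fintype ι] [DecidableEq ι] : PGL(ι, ℝ) →* Module.End ℝ (Pgl ι) :=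
  QuotientGroup.lift (Subgroup.center (GL ι ℝ)) (adGL ι) (by
    intro g hg
    refine Submodule.linearMap_qext _ (LinearMap.ext fun X => ?_)
    rw [Matrix.GeneralLinearGroup.center_eq_range_scalar] at hg
    obtain ⟨u, rfl⟩ := hg
    have h : conjGL (Matrix.GeneralLinearGroup.scalar ι u) X = X := by
      have hc : (Matrix.GeneralLinearGroup.scalar ι u).val * X =
          X * (Matrix.GeneralLinearGroup.scalar ι u).val := by
        simp [← Matrix.smul_eq_diagonal_mul, ← Matrix.op_smul_eq_mul_diagonal]
      change _ * X * _ = X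
      rw [hc, mul_assoc, Units.mul_inv, mul_one]
    exact congrArg Submodule.Quotient.mk h)

/-- The point `[0 : … : 0 : 1]` of `ℝP^m`. -/
def basePoint (m : ℕ) : ℙ ℝ (HIdx m → ℝ) :=
  Projectivization.mk ℝ (Pi.single (Sum.inr ()) 1) (by simp)

/-- The isotropy group `H` of `[0 : … : 0 : 1]` in `PGL(m + 1, ℝ)`, so that `PGL(m + 1, ℝ) / H` is
`ℝP^m`. -/
def isotropyGroup (m : ℕ) : Subgroup PGL(HIdx m, ℝ) :=
  MulAction.stabilizer PGL(HIdx m, ℝ) (basePoint m)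

/-- The Lie algebra `𝔥` of the isotropy group: the classes of the matrices that preserve the line
spanned by the last basis vector. -/
def isotropyAlgebra (m : ℕ) : Submodule ℝ (Pgl (HIdx m)) :=
  Submodule.map Pgl.mk
    { carrier := {X : Matrix (HIdx m) (HIdx m) ℝ | ∀ μ, X (Sum.inl μ) (Sum.inr ()) = 0}
      add_mem' := by
        intro X Y hX hY μ
        simp [hX μ, hY μ]
      zero_mem' := fun μ => rfl
      smul_mem' := by
        intro c X hX μ
        simp [hX μ] }

/-- The Lie algebra `𝔤̃` of the subgroup `G̃` that stabilises the hyperplane `X₀ = 0` (more precisely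
its preimage in `𝔤𝔩`): the matrices whose row `0` vanishes off the diagonal. -/
def gTilde (m : ℕ) : LieSubalgebra ℝ (Matrix (HIdx (m + 1)) (HIdx (m + 1)) ℝ) where
  carrier := {X | ∀ j, j ≠ Sum.inl 0 → X (Sum.inl 0) j = 0}
  add_mem' := by
    intro X Y hX hY j hj
    simp [hX j hj, hY j hj]
  zero_mem' := fun j _ => rfl
  smul_mem' := by
    intro c X hX j hj
    simp [hX j hj]
  lie_mem' := by
    intro X Y hX hY j hj
    have key : ∀ A B : Matrix (HIdx (m + 1)) (HIdx (m + 1)) ℝ,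
        (∀ j, j ≠ Sum.inl 0 → A (Sum.inl 0) j = 0) → (∀ j, j ≠ Sum.inl 0 → B (Sum.inl 0) j = 0) →
        (A * B) (Sum.inl 0) j = 0 := by
      intro A B hA hB
      rw [Matrix.mul_apply]
      refine Finset.sum_eq_zero fun k _ => ?_
      by_cases hk : k = Sum.inl 0
      · rw [hk, hB j hj, mul_zero]
      · rw [hA k hk, zero_mul]
    rw [Ring.lie_def, Matrix.sub_apply, key X Y hX hY, key Y X hY hX, sub_zero]

/-- The indices of the hyperplane `X₀ = 0` among those of `ℝP^(m+1)`. -/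
def hyperplaneIdx (m : ℕ) : HIdx m → HIdx (m + 1) :=
  Sum.map Fin.succ id

/-- Deletion of row and column `0`: the action of `𝔤̃` on the hyperplane, as a Lie algebra
homomorphism. -/
def restrictHyperplane (m : ℕ) : gTilde m →ₗ⁅ℝ⁆ Matrix (HIdx m) (HIdx m) ℝ where
  toFun X := X.val.submatrix (hyperplaneIdx m) (hyperplaneIdx m)
  map_add' X Y := rfl
  map_smul' c X := rfl
  map_lie' := by
    have key : ∀ A B : Matrix (HIdx (m + 1)) (HIdx (m + 1)) ℝ,
        (∀ j, j ≠ Sum.inl 0 → B (Sum.inl 0) j = 0) →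
        (A * B).submatrix (hyperplaneIdx m) (hyperplaneIdx m) =
          A.submatrix (hyperplaneIdx m) (hyperplaneIdx m) *
            B.submatrix (hyperplaneIdx m) (hyperplaneIdx m) := by
      intro A B hB
      ext i j
      have hj : hyperplaneIdx m j ≠ Sum.inl 0 := by
        rcases j with j | j <;> simp [hyperplaneIdx, Fin.succ_ne_zero]
      simp only [Matrix.submatrix_apply, Matrix.mul_apply, Fintype.sum_sum_type, Fin.sum_univ_succ,
        hB _ hj]
      simp [hyperplaneIdx]
    intro X Y
    change (X.val * Y.val - Y.val * X.val).submatrix _ _ = _ * _ - _ * _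
    rw [← key _ _ X.property, ← key _ _ Y.property]
    rfl

/-- The Lie algebra `𝔨` of the kernel `K = {(a, 0; b, λ I)}` of the action of `G̃` on the
hyperplane: the matrices `(a, 0; b, λ I)`. -/
def kIdeal (m : ℕ) : LieIdeal ℝ (gTilde m) where
  carrier := {X | ∃ c : ℝ, X.val.submatrix (hyperplaneIdx m) (hyperplaneIdx m) =
    c • (1 : Matrix (HIdx m) (HIdx m) ℝ)}
  add_mem' := by
    rintro X Y ⟨a, ha⟩ ⟨b, hb⟩
    refine ⟨a + b, ?_⟩
    rw [add_smul, ← ha, ← hb]; rfl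
  zero_mem' := ⟨0, by rw [zero_smul]; rfl⟩
  smul_mem' := by
    rintro c X ⟨a, ha⟩
    refine ⟨c * a, ?_⟩
    rw [← smul_smul, ← ha]; rfl
  lie_mem := by
    rintro X Y ⟨a, ha⟩
    have h : restrictHyperplane m Y = a • (1 : Matrix (HIdx m) (HIdx m) ℝ) := ha
    refine ⟨0, ?_⟩
    change restrictHyperplane m ⁅X, Y⁆ = _
    rw [LieHom.map_lie, h]
    simp [Ring.lie_def]

/-- `𝔤̃ / 𝔨 → 𝔭𝔤𝔩(m + 1)`, induced by the action of `𝔤̃` on the hyperplane. -/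
def gTildeQuotHom (m : ℕ) : (gTilde m ⧸ kIdeal m) →ₗ⁅ℝ⁆ Pgl (HIdx m) where
  toLinearMap := Submodule.liftQ (kIdeal m).toSubmodule
    (Pgl.mk ∘ₗ (restrictHyperplane m : gTilde m →ₗ[ℝ] Matrix (HIdx m) (HIdx m) ℝ)) (by
      intro X hX
      exact (Submodule.Quotient.mk_eq_zero _).2 hX)
  map_lie' := by
    intro X Y
    induction X using Submodule.Quotient.induction_on with | _ X =>
    induction Y using Submodule.Quotient.induction_on with | _ Y =>
    change Pgl.mk (restrictHyperplane m ⁅X, Y⁆) = _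
    rw [LieHom.map_lie]
    rfl

theorem gTildeQuotHom_bijective (m : ℕ) : Function.Bijective (gTildeQuotHom m) := by
  constructor
  · rw [injective_iff_map_eq_zero]
    intro X hX
    induction X using Submodule.Quotient.induction_on with | _ X =>
    have h : restrictHyperplane m X ∈ (scalarIdeal (HIdx m)).toSubmodule :=
      (Submodule.Quotient.mk_eq_zero _).1 hX
    exact (Submodule.Quotient.mk_eq_zero _).2 h
  · intro Z
    induction Z using Submodule.Quotient.induction_on with | _ Z =>
    refine ⟨Submodule.Quotient.mk ⟨Matrix.of fun i j =>
      match i, j with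
      | Sum.inl i, Sum.inl j => Fin.cases 0 (fun a => Fin.cases 0 (fun b => Z (.inl a) (.inl b)) j) i
      | Sum.inl i, Sum.inr _ => Fin.cases 0 (fun a => Z (.inl a) (.inr ())) i
      | Sum.inr _, Sum.inl j => Fin.cases 0 (fun b => Z (.inr ()) (.inl b)) j
      | Sum.inr _, Sum.inr _ => Z (.inr ()) (.inr ()), ?_⟩, ?_⟩
    · rintro (j | j) - <;> rfl
    · refine congrArg Submodule.Quotient.mk ?_
      ext i j
      rcases i with i | i <;> rcases j with j | j <;> rfl

/-- The identification `𝔤̃ / 𝔨 ≃ 𝔭𝔤𝔩(m + 1)` of `𝔤̃ / 𝔨` with the Lie algebra of the projective group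
of the hyperplane. -/
def gTildeQuotEquiv (m : ℕ) : (gTilde m ⧸ kIdeal m) ≃ₗ⁅ℝ⁆ Pgl (HIdx m) :=
  LieEquiv.ofBijective (gTildeQuotHom m) (gTildeQuotHom_bijective m)

/-! ### Cartan atlases and projective Cartan geometries

`N` is a smooth manifold of dimension `m`; the model is `ℝP^m = PGL(m + 1, ℝ) / H`. -/

section CartanGeometry

variable {m : ℕ} {N : Type*} [TopologicalSpace N] [ChartedSpace (EuclideanSpace ℝ (Fin m)) N]

/-- `D` is the pullback at `x` of the Maurer-Cartan form by the map `h`, which is smooth near `x`: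
for a smooth local lift `g` of `h` to `GL`, `D v` is the class of `g(x)⁻¹ dg(v)`. -/
def HasMaurerCartanAt (h : N → PGL(HIdx m, ℝ)) (x : N)
    (D : TangentSpace (𝓡 m) x →ₗ[ℝ] Pgl (HIdx m)) : Prop :=
  ∃ W ∈ 𝓝 x, ∃ g : N → GL (HIdx m) ℝ,
    (∀ a b, ContMDiffOn (𝓡 m) 𝓘(ℝ, ℝ) ∞ (fun y => (g y).val a b) W) ∧
    (∀ y ∈ W, Matrix.ProjGenLinGroup.mk (g y) = h y) ∧
    ∀ v : TangentSpace (𝓡 m) x, D v = Pgl.mk ((g x)⁻¹.val *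
      Matrix.of fun a b => (mfderiv (𝓡 m) 𝓘(ℝ, ℝ) (fun y => (g y).val a b) x v : ℝ))

variable (m N) in
/-- A `𝔭𝔤𝔩(m + 1)`-valued differential form on an open set `dom` of `N` (its values off `dom` are
irrelevant). -/
structure LocalForm where
  dom : TopologicalSpace.Opens N
  form : ∀ x : N, TangentSpace (𝓡 m) x →ₗ[ℝ] Pgl (HIdx m)

/-- `h` is a transition map from `θ` to `θ'`: a smooth map from the intersection of the domains to
the isotropy group `H` such that `θ' = h^* ω_H + Ad(h⁻¹) θ`. -/
def LocalForm.IsTransition (θ θ' : LocalForm m N) (h : N → PGL(HIdx m, ℝ)) : Prop :=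
  ∀ x ∈ θ.dom ⊓ θ'.dom, h x ∈ isotropyGroup m ∧
    ∃ D : TangentSpace (𝓡 m) x →ₗ[ℝ] Pgl (HIdx m), HasMaurerCartanAt h x D ∧
      θ'.form x = D + adPGL (HIdx m) (h x)⁻¹ ∘ₗ θ.form x

/-- Two local forms are compatible if they differ by a gauge transformation. -/
def LocalForm.Compatible (θ θ' : LocalForm m N) : Prop :=
  ∃ h : N → PGL(HIdx m, ℝ), θ.IsTransition θ' h

variable [IsManifold (𝓡 m) ∞ N]

/-- A Cartan gauge: a smooth local form that induces isomorphisms `T_x N ≃ 𝔤 / 𝔥`. Smoothness means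
that the components of the form, with respect to linear functionals on `𝔤`, are smooth functions on
the tangent bundle. -/
structure LocalForm.IsCartanGauge (θ : LocalForm m N) : Prop where
  smooth : ∀ l : Module.Dual ℝ (Pgl (HIdx m)),
    ContMDiffOn (𝓡 m).tangent 𝓘(ℝ, ℝ) ∞
      (fun v : TangentBundle (𝓡 m) N => l (θ.form v.proj v.snd)) (TotalSpace.proj ⁻¹' θ.dom)
  regular : ∀ x ∈ θ.dom, Function.Bijective ((isotropyAlgebra m).mkQ ∘ₗ θ.form x)

/-- A Cartan atlas on `N` modelled on `ℝP^m`: pairwise compatible Cartan gauges whose domains cover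
`N`. -/
structure IsCartanAtlas (A : Set (LocalForm m N)) : Prop where
  gauge : ∀ θ ∈ A, θ.IsCartanGauge
  cover : ∀ x : N, ∃ θ ∈ A, x ∈ θ.dom
  compatible : ∀ θ ∈ A, ∀ θ' ∈ A, θ.Compatible θ'

variable (m N) in
/-- A projective Cartan geometry on `N`, as a maximal Cartan atlas modelled on `ℝP^m`. -/
structure ProjectiveCartanGeometry where
  gauges : Set (LocalForm m N)
  isCartanAtlas : IsCartanAtlas gauges
  maximal : ∀ A : Set (LocalForm m N), IsCartanAtlas A → gauges ⊆ A → A = gauges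

end CartanGeometry

/-! ### Projective structures on a manifold with boundary -/

section ProjectiveStructure

variable (m : ℕ) (M : Type*) [TopologicalSpace M] [ChartedSpace (EuclideanHalfSpace (m + 1)) M]
  [IsManifold (𝓡∂ (m + 1)) ∞ M]

/-- A smooth torsion-free affine connection on `M`. -/
structure TorsionFreeConnection where
  cov : CovariantDerivative (𝓡∂ (m + 1)) (EuclideanSpace ℝ (Fin (m + 1)))
    (TangentSpace (𝓡∂ (m + 1)) : M → Type _)
  smooth : cov.ContMDiffCovariantDerivative ∞
  torsion_eq_zero : cov.torsion = 0

variable {m M}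

/-- Projective equivalence: `∇'_X Y = ∇_X Y + Υ(X) Y + Υ(Y) X` for a smooth `1`-form `Υ`. -/
def ProjectivelyEquivalent (a b : TorsionFreeConnection m M) : Prop :=
  ∃ Υ : ∀ x : M, TangentSpace (𝓡∂ (m + 1)) x →L[ℝ] ℝ,
    ContMDiff (𝓡∂ (m + 1)).tangent 𝓘(ℝ, ℝ) ∞
      (fun v : TangentBundle (𝓡∂ (m + 1)) M => Υ v.proj v.snd) ∧
    ∀ (Y : ∀ x : M, TangentSpace (𝓡∂ (m + 1)) x) (x : M),
      MDifferentiableAt (𝓡∂ (m + 1)) (𝓡∂ (m + 1)).tangent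
        (fun y => (⟨y, Y y⟩ : TangentBundle (𝓡∂ (m + 1)) M)) x →
      ∀ v : TangentSpace (𝓡∂ (m + 1)) x,
        b.cov Y x v = a.cov Y x v + Υ x v • Y x + Υ x (Y x) • v

instance projectiveSetoid (m : ℕ) (M : Type*) [TopologicalSpace M]
    [ChartedSpace (EuclideanHalfSpace (m + 1)) M] [IsManifold (𝓡∂ (m + 1)) ∞ M] :
    Setoid (TorsionFreeConnection m M) where
  r := ProjectivelyEquivalent
  iseqv := by
    refine ⟨fun a => ⟨0, ?_, ?_⟩, ?_, ?_⟩
    · simpa using contMDiff_const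
    · intro Y x _ v; simp
    · rintro a b ⟨Υ, hΥ, h⟩
      refine ⟨-Υ, ?_, ?_⟩
      · simpa using hΥ.neg
      · intro Y x hY v
        rw [h Y x hY v]
        simp only [Pi.neg_apply, neg_apply, neg_smul]
        abel
    · rintro a b c ⟨Υ, hΥ, h⟩ ⟨Υ', hΥ', h'⟩
      refine ⟨Υ + Υ', ?_, ?_⟩
      · exact hΥ.add hΥ'
      · intro Y x hY v
        rw [h' Y x hY v, h Y x hY v]
        simp only [Pi.add_apply, add_apply, add_smul]
        abel

variable (m M) in
/-- A projective structure: a class of projectively equivalent torsion-free connections. -/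
abbrev ProjectiveStructure : Type _ := Quotient (projectiveSetoid m M)

/-- The coordinate form `dx^i` of a chart, so that `dx^0 = dr` and `dx^(μ + 1) = dy^μ`. -/
def coordForm (e : OpenPartialHomeomorph M (EuclideanHalfSpace (m + 1))) (i : Fin (m + 1)) (x : M) :
    TangentSpace (𝓡∂ (m + 1)) x →L[ℝ] ℝ :=
  (EuclideanSpace.proj i : EuclideanSpace ℝ (Fin (m + 1)) →L[ℝ] ℝ) ∘L
    (mfderiv (𝓡∂ (m + 1)) 𝓘(ℝ, EuclideanSpace ℝ (Fin (m + 1))) (e.extend (𝓡∂ (m + 1))) x)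

/-- The coordinate vector field `∂/∂x^i` of a chart. -/
def coordField (e : OpenPartialHomeomorph M (EuclideanHalfSpace (m + 1))) (i : Fin (m + 1)) (x : M) :
    TangentSpace (𝓡∂ (m + 1)) x :=
  VectorField.mpullback (𝓡∂ (m + 1)) 𝓘(ℝ, EuclideanSpace ℝ (Fin (m + 1)))
    (e.extend (𝓡∂ (m + 1))) (fun _ => EuclideanSpace.single i 1) x

namespace TorsionFreeConnection

variable (α : TorsionFreeConnection m M)

/-- The local connection forms in a chart: `∇_v (∂/∂x^j) = ∑ i, α^i_j(v) ∂/∂x^i`. -/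
def connForm (e : OpenPartialHomeomorph M (EuclideanHalfSpace (m + 1))) (i j : Fin (m + 1)) (x : M) :
    TangentSpace (𝓡∂ (m + 1)) x →L[ℝ] ℝ :=
  coordForm e i x ∘L α.cov (coordField e j) x

/-- The curvature `R(X, Y) Z = ∇_X ∇_Y Z - ∇_Y ∇_X Z - ∇_[X, Y] Z`. -/
def curvature (X Y Z : ∀ x : M, TangentSpace (𝓡∂ (m + 1)) x) (x : M) :
    TangentSpace (𝓡∂ (m + 1)) x :=
  α.cov (fun y => α.cov Z y (Y y)) x (X x) - α.cov (fun y => α.cov Z y (X y)) x (Y x) -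
    α.cov Z x (VectorField.mlieBracket (𝓡∂ (m + 1)) X Y x)

/-- The components `R_jk` of the Ricci tensor, the trace of `X ↦ R(X, ∂/∂x^j) ∂/∂x^k`. -/
def ricci (e : OpenPartialHomeomorph M (EuclideanHalfSpace (m + 1))) (j k : Fin (m + 1)) (x : M) :
    ℝ :=
  ∑ i, coordForm e i x (α.curvature (coordField e i) (coordField e j) (coordField e k) x)

/-- The components of the projective Schouten tensor. In dimension `n = m + 1` it is defined by
`(n - 1) P_jk = R_jk - 2 / (n + 1) R_[jk]`, where `R_[jk] = (R_jk - R_kj) / 2`. -/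
def schouten (e : OpenPartialHomeomorph M (EuclideanHalfSpace (m + 1))) (j k : Fin (m + 1)) (x : M) :
    ℝ :=
  (α.ricci e j k x - 2 / (m + 2) * ((α.ricci e j k x - α.ricci e k j x) / 2)) / m

/-- The local gauge of the normal projective Cartan connection in a chart. With `n = m + 1` it is
the matrix of `1`-forms
`(α^i_j - 1 / (n + 1) α^l_l δ^i_j, dx^i; - ∑ i, P_ij dx^i, - 1 / (n + 1) α^l_l)`. -/
def gauge (e : OpenPartialHomeomorph M (EuclideanHalfSpace (m + 1))) (x : M) :
    TangentSpace (𝓡∂ (m + 1)) x →ₗ[ℝ] Matrix (HIdx (m + 1)) (HIdx (m + 1)) ℝ where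
  toFun v := Matrix.fromBlocks
    (Matrix.of fun i j => α.connForm e i j x v -
      if i = j then 1 / (m + 2) * ∑ l, α.connForm e l l x v else 0)
    (Matrix.of fun i _ => coordForm e i x v)
    (Matrix.of fun _ j => -∑ i, α.schouten e i j x * coordForm e i x v)
    (Matrix.of fun _ _ => -(1 / (m + 2) * ∑ l, α.connForm e l l x v))
  map_add' v w := by
    ext i j
    rcases i with i | i <;> rcases j with j | j <;>
      simp only [Matrix.fromBlocks_apply₁₁, Matrix.fromBlocks_apply₁₂, Matrix.fromBlocks_apply₂₁,
        Matrix.fromBlocks_apply₂₂, Matrix.add_apply, Matrix.of_apply, map_add, mul_add,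
        Finset.sum_add_distrib]
    · split_ifs <;> ring
    · ring
    · ring
  map_smul' c v := by
    ext i j
    rcases i with i | i <;> rcases j with j | j <;>
      simp only [Matrix.fromBlocks_apply₁₁, Matrix.fromBlocks_apply₁₂, Matrix.fromBlocks_apply₂₁,
        Matrix.fromBlocks_apply₂₂, Matrix.smul_apply, Matrix.of_apply, map_smul, smul_eq_mul,
        ← Finset.mul_sum, RingHom.id_apply, mul_left_comm _ c]
    · split_ifs <;> ring
    · ring
    · ring

/-- The pullback of the local gauge by the inclusion of the boundary. -/
def pullbackGauge (e : OpenPartialHomeomorph M (EuclideanHalfSpace (m + 1))) (x : Bdry m M) :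
    TangentSpace (𝓡 m) x →ₗ[ℝ] Matrix (HIdx (m + 1)) (HIdx (m + 1)) ℝ :=
  α.gauge e x.val ∘ₗ
    (mfderiv (𝓡 m) (𝓡∂ (m + 1)) (Subtype.val : Bdry m M → M) x).toLinearMap

open scoped Classical in
/-- The local form on `U ∩ ∂M`, for `U` the domain of a chart, obtained by reducing modulo `𝔨` the
pullback to `∂M` of the local gauge, where the latter takes its values in `𝔤̃`. -/
def boundaryForm (e : OpenPartialHomeomorph M (EuclideanHalfSpace (m + 1))) :
    LocalForm m (Bdry m M) where
  dom := ⟨{x | x.val ∈ e.source}, e.open_source.preimage continuous_subtype_val⟩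
  form x :=
    if h : ∀ v, α.pullbackGauge e x v ∈ (gTilde m).toSubmodule then
      (gTildeQuotEquiv m).toLinearEquiv.toLinearMap ∘ₗ (kIdeal m).toSubmodule.mkQ ∘ₗ
        LinearMap.codRestrict (gTilde m).toSubmodule (α.pullbackGauge e x) h
    else 0

end TorsionFreeConnection

/-- The non-rigidity condition: at every boundary point, for some boundary chart and some connection
in the class, the forms `α^0_μ`, `1 ≤ μ ≤ n - 1`, are multiples of `dr`. -/
def ProjectiveStructure.IsNonRigid (P : ProjectiveStructure m M) : Prop :=
  ∀ x ∈ (𝓡∂ (m + 1)).boundary M,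
    ∃ e ∈ IsManifold.maximalAtlas (𝓡∂ (m + 1)) ∞ M, x ∈ e.source ∧
      ∃ α : TorsionFreeConnection m M, (⟦α⟧ : ProjectiveStructure m M) = P ∧
        ∀ μ : Fin m, α.connForm e 0 μ.succ x ∈ Submodule.span ℝ {coordForm e 0 x}

end ProjectiveStructure

end

/-! Non-rigidity says that the boundary is totally geodesic: `α^0_μ` vanishes on vectors tangent to
`∂M`. This does not depend on the chart, because `∂r/∂y'^μ` vanishes along the boundary together
with its tangential derivatives, nor on the connection in the class, because the two `Υ` terms are
multiples of `dr(∂_μ)` and `dr(v)`, both zero (`connForm_zero_succ_boundaryDeriv`). As `dr` also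
dies on tangent vectors, row `0` of the pulled-back gauge vanishes off the diagonal, which is
membership in `𝔤̃`.

Reduction modulo `𝔨` deletes row and column `0` and absorbs the trace terms into the scalars,
leaving the class of `(α^μ_ν, dy^μ; -P_κν dy^κ, 0)` (`boundaryForm_form_eq`). Modulo `𝔥` only the
last column `dy^μ` survives, a coframe of `∂M`; this is regularity. Under a change of chart the
three blocks transform as a connection, a vector and a tensor under the tangential Jacobian, which
is exactly a gauge transformation by `diag(∂y/∂y', 1)` (`boundaryMatrix_change`); no determinant
normalisation is needed in `PGL`. The cocycle condition is the chain rule along the boundary. The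
laborious ingredient is that `P` is a tensor: curvature is defined through vector fields, so its
linearity over functions is proved slot by slot (`ricci_change`).

The maximal atlas consists of all gauges compatible with the given ones. Compatibility of two such
gauges is obtained locally through a given gauge, and the local transition maps must agree to be
glued. They do because a transition map from a Cartan gauge to itself is trivial
(`LocalForm.IsTransitionAt.eq_one`), so transition maps are unique
(`LocalForm.Compatible.of_cover`). -/

/-! ### Germs of smooth functions and vector fields, and brackets as commutators. -/

section SmoothGerms

variable {E : Type*} [NormedAddCommGroup E] [NormedSpace ℝ E]
  {H : Type*} [TopologicalSpace H] {I : ModelWithCorners ℝ E H}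
  {M : Type*} [TopologicalSpace M] [ChartedSpace H M]

variable (I) in
/-- The function `f` is smooth in a neighbourhood of `x`. -/
def SmoothFnAt (f : M → ℝ) (x : M) : Prop := ∀ᶠ y in 𝓝 x, ContMDiffAt I 𝓘(ℝ, ℝ) ∞ f y

variable {f g : M → ℝ} {x : M}

theorem SmoothFnAt.contMDiffAt (h : SmoothFnAt I f x) : ContMDiffAt I 𝓘(ℝ, ℝ) ∞ f x :=
  h.self_of_nhds

theorem SmoothFnAt.mdifferentiableAt (h : SmoothFnAt I f x) :
    MDifferentiableAt I 𝓘(ℝ, ℝ) f x :=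
  h.contMDiffAt.mdifferentiableAt (by simp)

/-- `ContMDiffAt` of order `∞` at `x` only gives finite orders on neighbourhoods that may shrink
with the order. Smoothness on one neighbourhood propagates to nearby points, as needed to
differentiate repeatedly. -/
theorem SmoothFnAt.eventually (h : SmoothFnAt I f x) : ∀ᶠ y in 𝓝 x, SmoothFnAt I f y :=
  eventually_eventually_nhds.2 h

theorem SmoothFnAt.congr (h : SmoothFnAt I f x) (hfg : g =ᶠ[𝓝 x] f) : SmoothFnAt I g x := by
  filter_upwards [h, hfg.eventuallyEq_nhds] with y h1 h2
  exact h1.congr_of_eventuallyEq h2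

theorem SmoothFnAt.add (hf : SmoothFnAt I f x) (hg : SmoothFnAt I g x) :
    SmoothFnAt I (fun y => f y + g y) x := by
  filter_upwards [hf, hg] with y h1 h2 using h1.add h2

theorem SmoothFnAt.sub (hf : SmoothFnAt I f x) (hg : SmoothFnAt I g x) :
    SmoothFnAt I (fun y => f y - g y) x := by
  filter_upwards [hf, hg] with y h1 h2 using h1.sub h2

theorem SmoothFnAt.mul (hf : SmoothFnAt I f x) (hg : SmoothFnAt I g x) :
    SmoothFnAt I (fun y => f y * g y) x := by
  filter_upwards [hf, hg] with y h1 h2 using h1.mul h2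

theorem smoothFnAt_const (c : ℝ) : SmoothFnAt I (fun _ : M => c) x :=
  Filter.Eventually.of_forall fun _ => contMDiffAt_const

theorem SmoothFnAt.sum {ι : Type*} {s : Finset ι} {F : ι → M → ℝ}
    (hF : ∀ i ∈ s, SmoothFnAt I (F i) x) : SmoothFnAt I (fun y => ∑ i ∈ s, F i y) x := by
  classical
  induction s using Finset.induction_on with
  | empty => simpa using smoothFnAt_const 0
  | insert a s ha ih =>
    simp only [Finset.sum_insert ha]
    exact (hF a (Finset.mem_insert_self a s)).add
      (ih fun i hi => hF i (Finset.mem_insert_of_mem hi))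

variable [IsManifold I ∞ M] {X Y Z : ∀ y : M, TangentSpace I y}

variable (I) in
/-- The vector field `X` is smooth in a neighbourhood of `x`. -/
def SmoothFieldAt (X : ∀ y : M, TangentSpace I y) (x : M) : Prop :=
  ∀ᶠ y in 𝓝 x, ContMDiffAt I I.tangent ∞ (fun z => (⟨z, X z⟩ : TangentBundle I M)) y

theorem SmoothFieldAt.eventually (h : SmoothFieldAt I X x) : ∀ᶠ y in 𝓝 x, SmoothFieldAt I X y :=
  eventually_eventually_nhds.2 h

theorem SmoothFieldAt.contMDiffAt (h : SmoothFieldAt I X x) :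
    ContMDiffAt I I.tangent ∞ (fun z => (⟨z, X z⟩ : TangentBundle I M)) x :=
  h.self_of_nhds

theorem SmoothFieldAt.congr (h : SmoothFieldAt I X x) (hXY : ∀ᶠ y in 𝓝 x, Y y = X y) :
    SmoothFieldAt I Y x := by
  filter_upwards [h, eventually_eventually_nhds.2 hXY] with y h1 h2
  refine h1.congr_of_eventuallyEq ?_
  filter_upwards [h2] with z hz
  rw [hz]

theorem SmoothFieldAt.mdifferentiableAt (h : SmoothFieldAt I X x) :
    MDifferentiableAt I I.tangent (fun z => (⟨z, X z⟩ : TangentBundle I M)) x :=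
  h.contMDiffAt.mdifferentiableAt (by simp)

theorem SmoothFieldAt.add (hX : SmoothFieldAt I X x) (hY : SmoothFieldAt I Y x) :
    SmoothFieldAt I (X + Y) x := by
  filter_upwards [hX, hY] with y h1 h2 using h1.add_section h2

theorem SmoothFieldAt.smul (hf : SmoothFnAt I f x) (hX : SmoothFieldAt I X x) :
    SmoothFieldAt I (f • X) x := by
  filter_upwards [hf, hX] with y h1 h2 using h1.smul_section h2

theorem smoothFieldAt_zero : SmoothFieldAt I (0 : ∀ y : M, TangentSpace I y) x :=
  Filter.Eventually.of_forall fun y =>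
    (contMDiff_zeroSection (IB := I) ℝ (TangentSpace I : M → Type _)) y

theorem SmoothFieldAt.sum {ι : Type*} {s : Finset ι} {F : ι → ∀ y : M, TangentSpace I y}
    (hF : ∀ i ∈ s, SmoothFieldAt I (F i) x) : SmoothFieldAt I (∑ i ∈ s, F i) x := by
  classical
  induction s using Finset.induction_on with
  | empty => simpa using smoothFieldAt_zero
  | insert a s ha ih =>
    rw [Finset.sum_insert ha]
    exact (hF a (Finset.mem_insert_self a s)).add
      (ih fun i hi => hF i (Finset.mem_insert_of_mem hi))

theorem SmoothFieldAt.mlieBracket [CompleteSpace E] (hX : SmoothFieldAt I X x)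
    (hY : SmoothFieldAt I Y x) : SmoothFieldAt I (VectorField.mlieBracket I X Y) x := by
  have : IsManifold I (minSmoothness ℝ 2) M := IsManifold.of_le (n := ∞) (by simp; exact WithTop.coe_le_coe.2 le_top)
  have : IsManifold I (((⊤ : ℕ∞) : ℕ∞ω) + 1) M := ‹IsManifold I ∞ M›
  filter_upwards [hX, hY] with y h1 h2
  exact ContMDiffAt.mlieBracket_vectorField (m := ⊤) (n := ⊤) h1 h2 (by simp)

/-- The function `df(X)` is the fibre component of the tangent map of `f` composed with the section
`X`. -/
theorem SmoothFieldAt.mvfderiv_apply (hf : SmoothFnAt I f x) (hX : SmoothFieldAt I X x) :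
    SmoothFnAt I (fun y => mvfderiv I f y (X y)) x := by
  filter_upwards [hf.eventually, hX] with y h1 h2
  have h3 : ContMDiffAt I.tangent 𝓘(ℝ, ℝ).tangent ∞ (tangentMap I 𝓘(ℝ, ℝ) f)
      (⟨y, X y⟩ : TangentBundle I M) := by
    obtain ⟨U, hU, hUo, hyU⟩ := eventually_nhds_iff.1 h1
    have hfU : ContMDiffOn I 𝓘(ℝ, ℝ) ∞ f U := fun z hz => (hU z hz).contMDiffWithinAt
    have h4 := hfU.contMDiffOn_tangentMapWithin (m := ∞) (by simp) hUo.uniqueMDiffOn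
    have h5 : (TotalSpace.proj ⁻¹' U : Set (TangentBundle I M)) ∈
        𝓝 (⟨y, X y⟩ : TangentBundle I M) :=
      (hUo.preimage (FiberBundle.continuous_proj E (TangentSpace I))).mem_nhds hyU
    refine (h4.contMDiffAt h5).congr_of_eventuallyEq ?_
    filter_upwards [h5] with z hz
    rw [tangentMapWithin_eq_tangentMap (hUo.uniqueMDiffWithinAt hz)
      ((hU _ hz).mdifferentiableAt (by simp))]
  have h4 : ContMDiffAt I 𝓘(ℝ, ℝ).tangent ∞
      (fun z => tangentMap I 𝓘(ℝ, ℝ) f (⟨z, X z⟩ : TangentBundle I M)) y :=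
    h3.comp y h2
  rw [contMDiffAt_totalSpace] at h4
  have h5 := h4.2
  simpa [mvfderiv, tangentMap] using! h5

/-- The commutator of the derivations defined by two vector fields is their bracket. -/
theorem SmoothFieldAt.mvfderiv_commutator [CompleteSpace E] (hf : SmoothFnAt I f x)
    (hX : SmoothFieldAt I X x) (hY : SmoothFieldAt I Y x) (hZ : SmoothFieldAt I Z x)
    (hZx : Z x ≠ 0) :
    mvfderiv I (fun y => mvfderiv I f y (Y y)) x (X x) -
      mvfderiv I (fun y => mvfderiv I f y (X y)) x (Y x) =
      mvfderiv I f x (VectorField.mlieBracket I X Y x) := by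
  have : IsManifold I (minSmoothness ℝ 2) M := IsManifold.of_le (n := ∞) (by simp; exact WithTop.coe_le_coe.2 le_top)
  have : IsManifold I (minSmoothness ℝ 3) M := IsManifold.of_le (n := ∞) (by simp; exact WithTop.coe_le_coe.2 le_top)
  have h2 : ∀ W : ∀ y : M, TangentSpace I y, SmoothFieldAt I W x →
      ContMDiffAt I I.tangent (minSmoothness ℝ 2) (fun z => (⟨z, W z⟩ : TangentBundle I M)) x :=
    fun W hW => hW.contMDiffAt.of_le (by simp; exact WithTop.coe_le_coe.2 le_top)
  -- Subtract `f` times the Jacobi identity for `Z` from the one for `f • Z`: the cross terms cancel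
  -- and a multiple of `Z x` remains, which is why `Z x ≠ 0` is required.
  have J := VectorField.leibniz_identity_mlieBracket_apply (h2 X hX) (h2 Y hY)
    (h2 _ (hZ.smul hf))
  have J' := VectorField.leibniz_identity_mlieBracket_apply (h2 X hX) (h2 Y hY) (h2 Z hZ)
  have expand : ∀ A B : ∀ y : M, TangentSpace I y, SmoothFieldAt I A x → SmoothFieldAt I B x →
      VectorField.mlieBracket I A (VectorField.mlieBracket I B (f • Z)) x =
        mvfderiv I (fun y => mvfderiv I f y (B y)) x (A x) • Z x +
        mvfderiv I f x (B x) • VectorField.mlieBracket I A Z x +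
        (mvfderiv I f x (A x) • VectorField.mlieBracket I B Z x +
        f x • VectorField.mlieBracket I A (VectorField.mlieBracket I B Z) x) := by
    intro A B hA hB
    have e1 : VectorField.mlieBracket I B (f • Z) =ᶠ[𝓝 x]
        (fun y => mvfderiv I f y (B y)) • Z + f • VectorField.mlieBracket I B Z := by
      filter_upwards [hf.eventually, hZ.eventually] with y hy1 hy2
      rw [VectorField.mlieBracket_smul_right hy1.mdifferentiableAt hy2.mdifferentiableAt]
      rfl
    refine (Filter.EventuallyEq.mlieBracket_vectorField_eq (V := A) (V₁ := A)
      Filter.EventuallyEq.rfl e1).trans ?_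
    have s1 := SmoothFieldAt.mvfderiv_apply hf hB
    have s2 := hB.mlieBracket hZ
    rw [VectorField.mlieBracket_add_right (hZ.smul s1).mdifferentiableAt
      (s2.smul hf).mdifferentiableAt,
      VectorField.mlieBracket_smul_right s1.mdifferentiableAt hZ.mdifferentiableAt,
      VectorField.mlieBracket_smul_right hf.mdifferentiableAt s2.mdifferentiableAt]
  rw [expand X Y hX hY, expand Y X hY hX,
    VectorField.mlieBracket_smul_right hf.mdifferentiableAt hZ.mdifferentiableAt, J'] at J
  have K : (mvfderiv I (fun y => mvfderiv I f y (Y y)) x (X x) -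
      mvfderiv I (fun y => mvfderiv I f y (X y)) x (Y x) -
      mvfderiv I f x (VectorField.mlieBracket I X Y x)) • Z x = 0 := by
    rw [smul_add] at J
    simp only [sub_smul]
    rw [← sub_eq_zero] at J
    rw [← J]
    abel
  exact sub_eq_zero.1 ((smul_eq_zero.1 K).resolve_right hZx)

/-- A locally defined smooth vector field agrees near a point with a global one. -/
theorem SmoothFieldAt.exists_contMDiff_eq [FiniteDimensional ℝ E] [T2Space M]
    (hX : SmoothFieldAt I X x) :
    ∃ X' : ∀ y : M, TangentSpace I y,
      ContMDiff I I.tangent ∞ (fun z => (⟨z, X' z⟩ : TangentBundle I M)) ∧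
      ∀ᶠ y in 𝓝 x, X' y = X y := by
  obtain ⟨U, hU, hUo, hxU⟩ := eventually_nhds_iff.1 hX
  obtain ⟨ψ, hψ, hψU⟩ := (SmoothBumpFunction.nhds_basis_tsupport (I := I) x).mem_iff.1
    (hUo.mem_nhds hxU)
  refine ⟨(ψ : M → ℝ) • X, ?_, ?_⟩
  · exact ContMDiffOn.smul_section_of_tsupport ψ.contMDiff.contMDiffOn hUo hψU
      fun z hz => (hU z hz).contMDiffWithinAt
  · filter_upwards [ψ.eventuallyEq_one] with y hy
    simp [Pi.smul_apply', hy]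

end SmoothGerms

/-! ### Locality of the covariant derivative and tensoriality of the curvature. -/

section Connection

variable {m : ℕ} {M : Type*} [TopologicalSpace M] [ChartedSpace (EuclideanHalfSpace (m + 1)) M]
  [IsManifold (𝓡∂ (m + 1)) ∞ M]

namespace TorsionFreeConnection

variable (α : TorsionFreeConnection m M) {f : M → ℝ}
  {X X' Y Y' Z Z' : ∀ x : M, TangentSpace (𝓡∂ (m + 1)) x} {x : M}

theorem cov_add (hX : SmoothFieldAt (𝓡∂ (m + 1)) X x) (hY : SmoothFieldAt (𝓡∂ (m + 1)) Y x)
    (v : TangentSpace (𝓡∂ (m + 1)) x) : α.cov (X + Y) x v = α.cov X x v + α.cov Y x v := by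
  rw [α.cov.isCovariantDerivativeOn.add hX.mdifferentiableAt hY.mdifferentiableAt]
  rfl

theorem cov_smul (hf : SmoothFnAt (𝓡∂ (m + 1)) f x) (hX : SmoothFieldAt (𝓡∂ (m + 1)) X x)
    (v : TangentSpace (𝓡∂ (m + 1)) x) :
    α.cov (f • X) x v = f x • α.cov X x v + mvfderiv (𝓡∂ (m + 1)) f x v • X x := by
  rw [α.cov.isCovariantDerivativeOn.leibniz hX.mdifferentiableAt hf.mdifferentiableAt]
  rfl

theorem cov_congr (hX : SmoothFieldAt (𝓡∂ (m + 1)) X x) (h : ∀ᶠ y in 𝓝 x, X' y = X y) :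
    α.cov X' x = α.cov X x :=
  α.cov.isCovariantDerivativeOn.congr_of_eventuallyEq (hX.congr h).mdifferentiableAt
    hX.mdifferentiableAt Filter.univ_mem h

theorem cov_sum_smul {ι : Type*} (s : Finset ι) {F : ι → M → ℝ}
    {W : ι → ∀ x : M, TangentSpace (𝓡∂ (m + 1)) x}
    (hF : ∀ i, SmoothFnAt (𝓡∂ (m + 1)) (F i) x) (hW : ∀ i, SmoothFieldAt (𝓡∂ (m + 1)) (W i) x)
    (v : TangentSpace (𝓡∂ (m + 1)) x) :
    α.cov (∑ i ∈ s, F i • W i) x v =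
      ∑ i ∈ s, (F i x • α.cov (W i) x v + mvfderiv (𝓡∂ (m + 1)) (F i) x v • W i x) := by
  classical
  induction s using Finset.induction_on with
  | empty => simp
  | insert a s ha ih =>
    rw [Finset.sum_insert ha, Finset.sum_insert ha, α.cov_add ((hW a).smul (hF a))
      (SmoothFieldAt.sum fun i _ => (hW i).smul (hF i)), ih, α.cov_smul (hF a) (hW a)]

/-- Smoothness of the connection is applied to sections smooth on all of `M`, so `Z` is first
replaced by a global field with the same germ; locality of `cov` undoes the replacement. -/
theorem smoothFieldAt_cov [T2Space M] (hX : SmoothFieldAt (𝓡∂ (m + 1)) X x)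
    (hZ : SmoothFieldAt (𝓡∂ (m + 1)) Z x) :
    SmoothFieldAt (𝓡∂ (m + 1)) (fun y => α.cov Z y (X y)) x := by
  obtain ⟨Z', hZ', hZZ'⟩ := hZ.exists_contMDiff_eq
  have h1 := α.smooth.contMDiff.contMDiff (σ := Z') (by simpa using hZ'.contMDiffOn)
  rw [contMDiffOn_univ] at h1
  have h2 : SmoothFieldAt (𝓡∂ (m + 1)) (fun y => α.cov Z' y (X y)) x := by
    filter_upwards [hX] with y hy
    exact (h1 y).clm_bundle_apply hy
  refine h2.congr ?_
  filter_upwards [hZ.eventually, eventually_eventually_nhds.2 hZZ'] with y hy hy'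
  rw [α.cov_congr hy hy']

theorem curvature_swap (X Y Z : ∀ x : M, TangentSpace (𝓡∂ (m + 1)) x) :
    α.curvature X Y Z x = -α.curvature Y X Z x := by
  simp only [curvature]
  rw [VectorField.mlieBracket_swap_apply, map_neg]
  abel

variable [T2Space M]

theorem smoothFieldAt_curvature (hX : SmoothFieldAt (𝓡∂ (m + 1)) X x)
    (hY : SmoothFieldAt (𝓡∂ (m + 1)) Y x) (hZ : SmoothFieldAt (𝓡∂ (m + 1)) Z x) :
    SmoothFieldAt (𝓡∂ (m + 1)) (α.curvature X Y Z) x := by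
  have h1 := α.smoothFieldAt_cov hX (α.smoothFieldAt_cov hY hZ)
  have h2 := α.smoothFieldAt_cov hY (α.smoothFieldAt_cov hX hZ)
  have h3 := α.smoothFieldAt_cov (hX.mlieBracket hY) hZ
  refine (h1.add (((h2.add h3)).smul (smoothFnAt_const (-1)))).congr
    (Filter.Eventually.of_forall fun y => ?_)
  simp only [curvature, Pi.add_apply, Pi.smul_apply']
  module

theorem curvature_add_left (hX : SmoothFieldAt (𝓡∂ (m + 1)) X x)
    (hX' : SmoothFieldAt (𝓡∂ (m + 1)) X' x) (hZ : SmoothFieldAt (𝓡∂ (m + 1)) Z x) :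
    α.curvature (X + X') Y Z x = α.curvature X Y Z x + α.curvature X' Y Z x := by
  have h1 : (fun y => α.cov Z y ((X + X') y)) =
      (fun y => α.cov Z y (X y)) + fun y => α.cov Z y (X' y) := by
    ext1 y; exact map_add _ _ _
  simp only [curvature]
  rw [VectorField.mlieBracket_add_left hX.mdifferentiableAt hX'.mdifferentiableAt, h1,
    α.cov_add (α.smoothFieldAt_cov hX hZ) (α.smoothFieldAt_cov hX' hZ)]
  simp only [Pi.add_apply, map_add]
  abel

/-- The term `(Y f) ∇_X Z` from `∇_Y (f ∇_X Z)` cancels the one from `[f X, Y] = f [X, Y] - (Y f)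
X`. -/
theorem curvature_smul_left (hf : SmoothFnAt (𝓡∂ (m + 1)) f x)
    (hX : SmoothFieldAt (𝓡∂ (m + 1)) X x) (hZ : SmoothFieldAt (𝓡∂ (m + 1)) Z x) :
    α.curvature (f • X) Y Z x = f x • α.curvature X Y Z x := by
  have h1 : (fun y => α.cov Z y ((f • X) y)) = f • fun y => α.cov Z y (X y) := by
    ext1 y; exact (α.cov Z y).map_smul _ _
  simp only [curvature]
  rw [VectorField.mlieBracket_smul_left hf.mdifferentiableAt hX.mdifferentiableAt, h1,
    α.cov_smul hf (α.smoothFieldAt_cov hX hZ)]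
  simp only [Pi.smul_apply', map_add, map_smul]
  module

theorem curvature_add_right (hX : SmoothFieldAt (𝓡∂ (m + 1)) X x)
    (hY : SmoothFieldAt (𝓡∂ (m + 1)) Y x) (hZ : SmoothFieldAt (𝓡∂ (m + 1)) Z x)
    (hZ' : SmoothFieldAt (𝓡∂ (m + 1)) Z' x) :
    α.curvature X Y (Z + Z') x = α.curvature X Y Z x + α.curvature X Y Z' x := by
  have h1 : ∀ W : ∀ x : M, TangentSpace (𝓡∂ (m + 1)) x, SmoothFieldAt (𝓡∂ (m + 1)) W x →
      α.cov (fun y => α.cov (Z + Z') y (W y)) x =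
      α.cov ((fun y => α.cov Z y (W y)) + fun y => α.cov Z' y (W y)) x := by
    intro W hW
    refine α.cov_congr ((α.smoothFieldAt_cov hW hZ).add (α.smoothFieldAt_cov hW hZ')) ?_
    filter_upwards [hZ.eventually, hZ'.eventually] with y h1 h2
    rw [α.cov_add h1 h2]
    rfl
  simp only [curvature]
  rw [h1 X hX, h1 Y hY, α.cov_add (α.smoothFieldAt_cov hX hZ) (α.smoothFieldAt_cov hX hZ'),
    α.cov_add (α.smoothFieldAt_cov hY hZ) (α.smoothFieldAt_cov hY hZ'), α.cov_add hZ hZ']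
  abel

/-- The first-order cross terms are symmetric in `X` and `Y`, and the second-order terms `X(Yf) -
Y(Xf)` cancel against `[X, Y] f`. The condition on `Z x` comes from the commutator formula;
coordinate fields satisfy it. -/
theorem curvature_smul_right (hf : SmoothFnAt (𝓡∂ (m + 1)) f x)
    (hX : SmoothFieldAt (𝓡∂ (m + 1)) X x)
    (hY : SmoothFieldAt (𝓡∂ (m + 1)) Y x) (hZ : SmoothFieldAt (𝓡∂ (m + 1)) Z x) (hZx : Z x ≠ 0) :
    α.curvature X Y (f • Z) x = f x • α.curvature X Y Z x := by
  have h1 : ∀ V W : ∀ x : M, TangentSpace (𝓡∂ (m + 1)) x, SmoothFieldAt (𝓡∂ (m + 1)) W x →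
      α.cov (fun y => α.cov (f • Z) y (W y)) x (V x) =
      f x • α.cov (fun y => α.cov Z y (W y)) x (V x) +
      mvfderiv (𝓡∂ (m + 1)) f x (V x) • α.cov Z x (W x) +
      (mvfderiv (𝓡∂ (m + 1)) f x (W x) • α.cov Z x (V x) +
      mvfderiv (𝓡∂ (m + 1)) (fun y => mvfderiv (𝓡∂ (m + 1)) f y (W y)) x (V x) • Z x) := by
    intro V W hW
    have s1 := α.smoothFieldAt_cov hW hZ
    have s2 := SmoothFieldAt.mvfderiv_apply hf hW
    have h2 : α.cov (fun y => α.cov (f • Z) y (W y)) x =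
        α.cov ((f • fun y => α.cov Z y (W y)) +
          (fun y => mvfderiv (𝓡∂ (m + 1)) f y (W y)) • Z) x := by
      refine α.cov_congr ((s1.smul hf).add (hZ.smul s2)) ?_
      filter_upwards [hZ.eventually, hf.eventually] with y h1 h2
      rw [α.cov_smul h2 h1]
      rfl
    rw [h2, α.cov_add (s1.smul hf) (hZ.smul s2), α.cov_smul hf s1, α.cov_smul s2 hZ]
  have h3 := SmoothFieldAt.mvfderiv_commutator hf hX hY hZ hZx
  simp only [curvature]
  rw [h1 X Y hY, h1 Y X hX, α.cov_smul hf hZ, ← h3]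
  module

/-- Curvature depends only on germs. This is needed because one coordinate frame expands in another
only on the chart domain. -/
theorem curvature_congr (hX : SmoothFieldAt (𝓡∂ (m + 1)) X x)
    (hY : SmoothFieldAt (𝓡∂ (m + 1)) Y x) (hZ : SmoothFieldAt (𝓡∂ (m + 1)) Z x)
    (h1 : ∀ᶠ y in 𝓝 x, X' y = X y) (h2 : ∀ᶠ y in 𝓝 x, Y' y = Y y)
    (h3 : ∀ᶠ y in 𝓝 x, Z' y = Z y) : α.curvature X' Y' Z' x = α.curvature X Y Z x := by
  have key : ∀ {W W' : ∀ x : M, TangentSpace (𝓡∂ (m + 1)) x}, SmoothFieldAt (𝓡∂ (m + 1)) W x →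
      (∀ᶠ y in 𝓝 x, W' y = W y) → α.cov (fun y => α.cov Z' y (W' y)) x =
        α.cov (fun y => α.cov Z y (W y)) x := by
    intro W W' hW h
    refine α.cov_congr (α.smoothFieldAt_cov hW hZ) ?_
    filter_upwards [hZ.eventually, eventually_eventually_nhds.2 h3, h] with y k1 k2 k3
    rw [α.cov_congr k1 k2, k3]
  simp only [curvature]
  rw [key hX h1, key hY h2, α.cov_congr hZ h3, h1.self_of_nhds, h2.self_of_nhds,
    Filter.EventuallyEq.mlieBracket_vectorField_eq h1 h2]

theorem curvature_sum_left {ι : Type*} (s : Finset ι) {F : ι → M → ℝ}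
    {W : ι → ∀ x : M, TangentSpace (𝓡∂ (m + 1)) x}
    (hF : ∀ i, SmoothFnAt (𝓡∂ (m + 1)) (F i) x) (hW : ∀ i, SmoothFieldAt (𝓡∂ (m + 1)) (W i) x)
    (hZ : SmoothFieldAt (𝓡∂ (m + 1)) Z x) :
    α.curvature (∑ i ∈ s, F i • W i) Y Z x = ∑ i ∈ s, F i x • α.curvature (W i) Y Z x := by
  classical
  induction s using Finset.induction_on with
  | empty =>
    have h : (fun y => α.cov Z y ((0 : ∀ x : M, TangentSpace (𝓡∂ (m + 1)) x) y)) = 0 := by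
      ext1 y; exact map_zero _
    simp only [Finset.sum_empty, curvature]
    rw [h]
    simp
  | insert a s ha ih =>
    rw [Finset.sum_insert ha, Finset.sum_insert ha, α.curvature_add_left ((hW a).smul (hF a))
      (SmoothFieldAt.sum fun i _ => (hW i).smul (hF i)) hZ, ih,
      α.curvature_smul_left (hF a) (hW a) hZ]

theorem curvature_sum_middle {ι : Type*} (s : Finset ι) {F : ι → M → ℝ}
    {W : ι → ∀ x : M, TangentSpace (𝓡∂ (m + 1)) x}
    (hF : ∀ i, SmoothFnAt (𝓡∂ (m + 1)) (F i) x) (hW : ∀ i, SmoothFieldAt (𝓡∂ (m + 1)) (W i) x)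
    (hZ : SmoothFieldAt (𝓡∂ (m + 1)) Z x) :
    α.curvature X (∑ i ∈ s, F i • W i) Z x = ∑ i ∈ s, F i x • α.curvature X (W i) Z x := by
  rw [curvature_swap, α.curvature_sum_left s hF hW hZ, ← Finset.sum_neg_distrib]
  refine Finset.sum_congr rfl fun i _ => ?_
  rw [α.curvature_swap X, smul_neg]

theorem curvature_sum_right {ι : Type*} (s : Finset ι) {F : ι → M → ℝ}
    {W : ι → ∀ x : M, TangentSpace (𝓡∂ (m + 1)) x}
    (hF : ∀ i, SmoothFnAt (𝓡∂ (m + 1)) (F i) x) (hW : ∀ i, SmoothFieldAt (𝓡∂ (m + 1)) (W i) x)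
    (hW0 : ∀ i, W i x ≠ 0) (hX : SmoothFieldAt (𝓡∂ (m + 1)) X x)
    (hY : SmoothFieldAt (𝓡∂ (m + 1)) Y x) :
    α.curvature X Y (∑ i ∈ s, F i • W i) x = ∑ i ∈ s, F i x • α.curvature X Y (W i) x := by
  classical
  induction s using Finset.induction_on with
  | empty =>
    have h : ∀ V : ∀ x : M, TangentSpace (𝓡∂ (m + 1)) x, (fun y => α.cov 0 y (V y)) = 0 := by
      intro V
      ext1 y
      rw [α.cov.isCovariantDerivativeOn.zero]
      rfl
    simp only [Finset.sum_empty, curvature, h]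
    rw [α.cov.isCovariantDerivativeOn.zero]
    simp
  | insert a s ha ih =>
    rw [Finset.sum_insert ha, Finset.sum_insert ha, α.curvature_add_right hX hY
      ((hW a).smul (hF a)) (SmoothFieldAt.sum fun i _ => (hW i).smul (hF i)), ih,
      α.curvature_smul_right (hF a) hX hY (hW a) (hW0 a)]

end TorsionFreeConnection

end Connection

/-! ### Coordinate frames, Jacobians, and the transformation laws of `α` and `P`. -/

section Charts

variable {m : ℕ} {M : Type*} [TopologicalSpace M] [ChartedSpace (EuclideanHalfSpace (m + 1)) M]
  {e e' e'' : OpenPartialHomeomorph M (EuclideanHalfSpace (m + 1))}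
  {x : M}

/-- The inverse chart is differentiable within the half-space, and the chain rule makes its
derivative a left inverse of this one; equality of dimensions does the rest. -/
theorem isInvertible_mfderiv_extend (he : e ∈ IsManifold.maximalAtlas (𝓡∂ (m + 1)) ∞ M)
    (hx : x ∈ e.source) :
    (mfderiv (𝓡∂ (m + 1)) 𝓘(ℝ, EuclideanSpace ℝ (Fin (m + 1)))
      (e.extend (𝓡∂ (m + 1))) x).IsInvertible := by
  have hf := (e.contMDiffAt_extend he hx).mdifferentiableAt (by simp)
  have hxe : x ∈ (e.extend (𝓡∂ (m + 1))).source := by rwa [e.extend_source]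
  have hg : MDifferentiableWithinAt 𝓘(ℝ, EuclideanSpace ℝ (Fin (m + 1))) (𝓡∂ (m + 1))
      (e.extend (𝓡∂ (m + 1))).symm (range (𝓡∂ (m + 1))) (e.extend (𝓡∂ (m + 1)) x) := by
    refine ((contMDiffOn_extend_symm he _ ?_).mdifferentiableWithinAt (by simp)).mono_of_mem_nhdsWithin
      ?_
    · exact ⟨e x, e.map_source hx, rfl⟩
    · rw [← e.extend_target']
      exact e.extend_target_mem_nhdsWithin hx
  have h1 := HasMFDerivWithinAt.comp x hg.hasMFDerivWithinAt
    (hf.hasMFDerivAt.hasMFDerivWithinAt (s := univ)) (fun y _ => ⟨e y, rfl⟩)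
  rw [hasMFDerivWithinAt_univ] at h1
  have h2 : HasMFDerivAt (𝓡∂ (m + 1)) (𝓡∂ (m + 1))
      ((e.extend (𝓡∂ (m + 1))).symm ∘ e.extend (𝓡∂ (m + 1))) x
      (ContinuousLinearMap.id ℝ (TangentSpace (𝓡∂ (m + 1)) x)) := by
    refine (hasMFDerivAt_id x).congr_of_eventuallyEq ?_
    filter_upwards [e.open_source.mem_nhds hx] with y hy
    exact e.extend_left_inv hy
  have h3 := hasMFDerivAt_unique h1 h2
  have hinj : Function.Injective (mfderiv (𝓡∂ (m + 1)) 𝓘(ℝ, EuclideanSpace ℝ (Fin (m + 1)))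
      (e.extend (𝓡∂ (m + 1))) x) := by
    refine Function.LeftInverse.injective 
      (g := mfderivWithin 𝓘(ℝ, EuclideanSpace ℝ (Fin (m + 1))) (𝓡∂ (m + 1))
        (e.extend (𝓡∂ (m + 1))).symm (range (𝓡∂ (m + 1))) (e.extend (𝓡∂ (m + 1)) x)) fun v => ?_
    exact DFunLike.congr_fun h3 v
  have key : ∀ F : EuclideanSpace ℝ (Fin (m + 1)) →L[ℝ] EuclideanSpace ℝ (Fin (m + 1)),
      Function.Injective F → F.IsInvertible := fun F hF =>
    ⟨(LinearMap.linearEquivOfInjective F.toLinearMap hF rfl).toContinuousLinearEquiv, rfl⟩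
  exact key _ hinj

theorem coordForm_eq_mvfderiv (he : e ∈ IsManifold.maximalAtlas (𝓡∂ (m + 1)) ∞ M)
    (hx : x ∈ e.source) (i : Fin (m + 1)) :
    coordForm e i x = mvfderiv (𝓡∂ (m + 1)) (fun y => e.extend (𝓡∂ (m + 1)) y i) x := by
  have h1 := (e.contMDiffAt_extend he hx).mdifferentiableAt (by simp)
  have h2 : MDifferentiableAt 𝓘(ℝ, EuclideanSpace ℝ (Fin (m + 1))) 𝓘(ℝ, ℝ)
    (EuclideanSpace.proj i : EuclideanSpace ℝ (Fin (m + 1)) →L[ℝ] ℝ)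
    (e.extend (𝓡∂ (m + 1)) x) := (ContinuousLinearMap.differentiableAt _).mdifferentiableAt
  have h3 := mfderiv_comp x h2 h1
  rw [mfderiv_eq_fderiv, ContinuousLinearMap.fderiv] at h3
  exact h3.symm

theorem smoothFnAt_coord (he : e ∈ IsManifold.maximalAtlas (𝓡∂ (m + 1)) ∞ M)
    (hx : x ∈ e.source) (i : Fin (m + 1)) :
    SmoothFnAt (𝓡∂ (m + 1)) (fun y => e.extend (𝓡∂ (m + 1)) y i) x := by
  filter_upwards [e.open_source.mem_nhds hx] with y hy
  exact (EuclideanSpace.proj i : EuclideanSpace ℝ (Fin (m + 1)) →L[ℝ] ℝ).contMDiff.contMDiffAt.comp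
    y (e.contMDiffAt_extend he hy)

theorem coordForm_coordField (he : e ∈ IsManifold.maximalAtlas (𝓡∂ (m + 1)) ∞ M)
    (hx : x ∈ e.source) (i j : Fin (m + 1)) :
    coordForm e i x (coordField e j x) = if i = j then 1 else 0 := by
  have h := (isInvertible_mfderiv_extend he hx).self_apply_inverse
    (y := (EuclideanSpace.single j 1 : EuclideanSpace ℝ (Fin (m + 1))))
  have h2 : coordForm e i x (coordField e j x) =
    (EuclideanSpace.single j (1:ℝ) : EuclideanSpace ℝ (Fin (m + 1))) i :=
    congrArg (fun v : EuclideanSpace ℝ (Fin (m + 1)) => v i) h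
  rw [h2]
  simp

theorem ext_coordForm (he : e ∈ IsManifold.maximalAtlas (𝓡∂ (m + 1)) ∞ M)
    (hx : x ∈ e.source) {v w : TangentSpace (𝓡∂ (m + 1)) x}
    (h : ∀ i, coordForm e i x v = coordForm e i x w) : v = w := by
  refine (isInvertible_mfderiv_extend he hx).injective ?_
  exact PiLp.ext h

theorem coordField_ne_zero (he : e ∈ IsManifold.maximalAtlas (𝓡∂ (m + 1)) ∞ M)
    (hx : x ∈ e.source) (j : Fin (m + 1)) : coordField e j x ≠ 0 := by
  intro h
  simpa [h] using coordForm_coordField he hx j j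

theorem sum_coordForm_smul_coordField (he : e ∈ IsManifold.maximalAtlas (𝓡∂ (m + 1)) ∞ M)
    (hx : x ∈ e.source) (v : TangentSpace (𝓡∂ (m + 1)) x) :
    ∑ i, coordForm e i x v • coordField e i x = v := by
  refine ext_coordForm he hx fun i => ?_
  simp [coordForm_coordField he hx]

variable (e e') in
/-- The Jacobian matrix `∂x^i/∂x'^j` of a change of charts. -/
noncomputable def chartJacobian (i j : Fin (m + 1)) (x : M) : ℝ := coordForm e i x (coordField e' j x)

theorem coordForm_eq_sum_chartJacobian (he' : e' ∈ IsManifold.maximalAtlas (𝓡∂ (m + 1)) ∞ M)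
    (hx' : x ∈ e'.source) (i : Fin (m + 1)) (v : TangentSpace (𝓡∂ (m + 1)) x) :
    coordForm e i x v = ∑ k, chartJacobian e e' i k x * coordForm e' k x v := by
  conv_lhs => rw [← sum_coordForm_smul_coordField he' hx' v]
  simp only [map_sum, map_smul, smul_eq_mul, chartJacobian, mul_comm]

theorem coordField_eq_sum_chartJacobian (he : e ∈ IsManifold.maximalAtlas (𝓡∂ (m + 1)) ∞ M)
    (hx : x ∈ e.source) (j : Fin (m + 1)) :
    coordField e' j x = ∑ k, chartJacobian e e' k j x • coordField e k x :=
  (sum_coordForm_smul_coordField he hx _).symm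

theorem sum_chartJacobian_mul (he' : e' ∈ IsManifold.maximalAtlas (𝓡∂ (m + 1)) ∞ M)
    (hx' : x ∈ e'.source) (i j : Fin (m + 1)) :
    ∑ k, chartJacobian e e' i k x * chartJacobian e' e'' k j x = chartJacobian e e'' i j x :=
  (coordForm_eq_sum_chartJacobian he' hx' i _).symm

theorem chartJacobian_self (he : e ∈ IsManifold.maximalAtlas (𝓡∂ (m + 1)) ∞ M)
    (hx : x ∈ e.source) (i j : Fin (m + 1)) :
    chartJacobian e e i j x = if i = j then 1 else 0 :=
  coordForm_coordField he hx i j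

theorem eventually_coordField_eq_sum (he : e ∈ IsManifold.maximalAtlas (𝓡∂ (m + 1)) ∞ M)
    (hx : x ∈ e.source) (j : Fin (m + 1)) :
    ∀ᶠ y in 𝓝 x, coordField e' j y = (∑ k, chartJacobian e e' k j • coordField e k) y := by
  filter_upwards [e.open_source.mem_nhds hx] with y hy
  rw [Finset.sum_apply]
  exact coordField_eq_sum_chartJacobian he hy j

variable [IsManifold (𝓡∂ (m + 1)) ∞ M]

theorem smoothFnAt_coordForm (he : e ∈ IsManifold.maximalAtlas (𝓡∂ (m + 1)) ∞ M)
    (hx : x ∈ e.source) (i : Fin (m + 1)) {X : ∀ x : M, TangentSpace (𝓡∂ (m + 1)) x}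
    (hX : SmoothFieldAt (𝓡∂ (m + 1)) X x) :
    SmoothFnAt (𝓡∂ (m + 1)) (fun y => coordForm e i y (X y)) x := by
  refine (SmoothFieldAt.mvfderiv_apply (smoothFnAt_coord he hx i) hX).congr ?_
  filter_upwards [e.open_source.mem_nhds hx] with y hy
  rw [coordForm_eq_mvfderiv he hy]

theorem smoothFieldAt_coordField (he : e ∈ IsManifold.maximalAtlas (𝓡∂ (m + 1)) ∞ M)
    (hx : x ∈ e.source) (j : Fin (m + 1)) : SmoothFieldAt (𝓡∂ (m + 1)) (coordField e j) x := by
  filter_upwards [e.open_source.mem_nhds hx] with y hy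
  refine ContMDiffAt.mpullback_vectorField_preimage (n := ∞) ?_ (e.contMDiffAt_extend he hy)
    (isInvertible_mfderiv_extend he hy) (by simp)
  exact contMDiffAt_vectorSpace_iff_contDiffAt.2 contDiffAt_const

theorem smoothFnAt_chartJacobian (he : e ∈ IsManifold.maximalAtlas (𝓡∂ (m + 1)) ∞ M)
    (hx : x ∈ e.source) (he' : e' ∈ IsManifold.maximalAtlas (𝓡∂ (m + 1)) ∞ M)
    (hx' : x ∈ e'.source) (i j : Fin (m + 1)) :
    SmoothFnAt (𝓡∂ (m + 1)) (chartJacobian e e' i j) x :=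
  smoothFnAt_coordForm he hx i (smoothFieldAt_coordField he' hx' j)

namespace TorsionFreeConnection

variable (α : TorsionFreeConnection m M)

/-- The transformation law of the local connection forms. -/
theorem connForm_change (he : e ∈ IsManifold.maximalAtlas (𝓡∂ (m + 1)) ∞ M)
    (hx : x ∈ e.source) (he' : e' ∈ IsManifold.maximalAtlas (𝓡∂ (m + 1)) ∞ M)
    (hx' : x ∈ e'.source) (i j : Fin (m + 1)) (v : TangentSpace (𝓡∂ (m + 1)) x) :
    α.connForm e' i j x v = ∑ k, chartJacobian e' e i k x *
      (mvfderiv (𝓡∂ (m + 1)) (chartJacobian e e' k j) x v +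
        ∑ l, α.connForm e k l x v * chartJacobian e e' l j x) := by
  have h1 : α.cov (coordField e' j) x v =
      ∑ k, (chartJacobian e e' k j x • α.cov (coordField e k) x v +
        mvfderiv (𝓡∂ (m + 1)) (chartJacobian e e' k j) x v • coordField e k x) := by
    rw [α.cov_congr (SmoothFieldAt.sum fun k _ => (smoothFieldAt_coordField he hx k).smul
      (smoothFnAt_chartJacobian he hx he' hx' k j)) (eventually_coordField_eq_sum he hx j),
      α.cov_sum_smul _ (fun k => smoothFnAt_chartJacobian he hx he' hx' k j)
      (fun k => smoothFieldAt_coordField he hx k)]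
  have h2 : α.connForm e' i j x v = coordForm e' i x (α.cov (coordField e' j) x v) := rfl
  rw [h2, coordForm_eq_sum_chartJacobian he hx]
  refine Finset.sum_congr rfl fun k _ => ?_
  rw [h1]
  simp only [map_sum, map_add, map_smul, smul_eq_mul, coordForm_coordField he hx,
    Finset.sum_add_distrib]
  rw [add_comm]
  congr 2
  · simp
  · exact Finset.sum_congr rfl fun l _ => mul_comm _ _

variable [T2Space M]

theorem smoothFnAt_connForm (he : e ∈ IsManifold.maximalAtlas (𝓡∂ (m + 1)) ∞ M)
    (hx : x ∈ e.source) (i j : Fin (m + 1)) {X : ∀ x : M, TangentSpace (𝓡∂ (m + 1)) x}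
    (hX : SmoothFieldAt (𝓡∂ (m + 1)) X x) :
    SmoothFnAt (𝓡∂ (m + 1)) (fun y => α.connForm e i j y (X y)) x :=
  smoothFnAt_coordForm he hx i (α.smoothFieldAt_cov hX (smoothFieldAt_coordField he hx j))

theorem smoothFnAt_ricci (he : e ∈ IsManifold.maximalAtlas (𝓡∂ (m + 1)) ∞ M)
    (hx : x ∈ e.source) (j k : Fin (m + 1)) : SmoothFnAt (𝓡∂ (m + 1)) (α.ricci e j k) x :=
  SmoothFnAt.sum fun i _ => smoothFnAt_coordForm he hx i (α.smoothFieldAt_curvature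
    (smoothFieldAt_coordField he hx i) (smoothFieldAt_coordField he hx j)
    (smoothFieldAt_coordField he hx k))

theorem smoothFnAt_schouten (he : e ∈ IsManifold.maximalAtlas (𝓡∂ (m + 1)) ∞ M)
    (hx : x ∈ e.source) (j k : Fin (m + 1)) : SmoothFnAt (𝓡∂ (m + 1)) (α.schouten e j k) x := by
  have h := ((α.smoothFnAt_ricci he hx j k).sub ((smoothFnAt_const (2 / (m + 2))).mul
    (((α.smoothFnAt_ricci he hx j k).sub (α.smoothFnAt_ricci he hx k j)).mul
      (smoothFnAt_const 2⁻¹)))).mul (smoothFnAt_const (m : ℝ)⁻¹)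
  simpa only [← div_eq_mul_inv] using! h

/-- The Ricci tensor is a tensor. -/
theorem ricci_change (he : e ∈ IsManifold.maximalAtlas (𝓡∂ (m + 1)) ∞ M)
    (hx : x ∈ e.source) (he' : e' ∈ IsManifold.maximalAtlas (𝓡∂ (m + 1)) ∞ M)
    (hx' : x ∈ e'.source) (j k : Fin (m + 1)) :
    α.ricci e' j k x =
      ∑ c, ∑ d, chartJacobian e e' c j x * chartJacobian e e' d k x * α.ricci e c d x := by
  have hJ := smoothFnAt_chartJacobian he hx he' hx'
  have hE := smoothFieldAt_coordField he hx
  have hE' : ∀ j, SmoothFieldAt (𝓡∂ (m + 1)) (∑ k, chartJacobian e e' k j • coordField e k) x :=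
    fun j => SmoothFieldAt.sum fun k _ => (hE k).smul (hJ k j)
  have h1 : ∀ i, α.curvature (coordField e' i) (coordField e' j) (coordField e' k) x =
      ∑ b, ∑ c, ∑ d, (chartJacobian e e' b i x * chartJacobian e e' c j x *
        chartJacobian e e' d k x) •
        α.curvature (coordField e b) (coordField e c) (coordField e d) x := by
    intro i
    rw [α.curvature_congr (hE' i) (hE' j) (hE' k) (eventually_coordField_eq_sum he hx i)
      (eventually_coordField_eq_sum he hx j) (eventually_coordField_eq_sum he hx k),
      α.curvature_sum_left _ (fun b => hJ b i) hE (hE' k)]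
    refine Finset.sum_congr rfl fun b _ => ?_
    rw [α.curvature_sum_middle _ (fun c => hJ c j) hE (hE' k), Finset.smul_sum]
    refine Finset.sum_congr rfl fun c _ => ?_
    rw [α.curvature_sum_right _ (fun d => hJ d k) hE (fun d => coordField_ne_zero he hx d)
      (hE b) (hE c), Finset.smul_sum, Finset.smul_sum]
    refine Finset.sum_congr rfl fun d _ => ?_
    rw [smul_smul, smul_smul, mul_assoc]
  -- The two Jacobians are mutually inverse, so contracting them collapses the trace taken in the
  -- frame of `e'` to the trace in the frame of `e`.
  have h2 : ∀ b a, ∑ i, chartJacobian e' e i a x * chartJacobian e e' b i x =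
      if b = a then 1 else 0 := by
    intro b a
    rw [← chartJacobian_self he hx b a, ← sum_chartJacobian_mul he' hx']
    exact Finset.sum_congr rfl fun i _ => mul_comm _ _
  have h3 : α.ricci e' j k x = ∑ i, ∑ a, ∑ b, ∑ c, ∑ d,
      (chartJacobian e' e i a x * chartJacobian e e' b i x) *
      (chartJacobian e e' c j x * chartJacobian e e' d k x *
      coordForm e a x (α.curvature (coordField e b) (coordField e c) (coordField e d) x)) := by
    refine Finset.sum_congr rfl fun i _ => ?_
    rw [h1, coordForm_eq_sum_chartJacobian he hx]
    refine Finset.sum_congr rfl fun a _ => ?_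
    simp only [map_sum, map_smul, smul_eq_mul, Finset.mul_sum]
    refine Finset.sum_congr rfl fun b _ => Finset.sum_congr rfl fun c _ =>
      Finset.sum_congr rfl fun d _ => by ring
  have h4 : α.ricci e' j k x = ∑ a, ∑ b, (∑ i, chartJacobian e' e i a x *
      chartJacobian e e' b i x) * ∑ c, ∑ d, chartJacobian e e' c j x * chartJacobian e e' d k x *
      coordForm e a x (α.curvature (coordField e b) (coordField e c) (coordField e d) x) := by
    rw [h3, Finset.sum_comm]
    refine Finset.sum_congr rfl fun a _ => ?_
    rw [Finset.sum_comm]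
    refine Finset.sum_congr rfl fun b _ => ?_
    rw [Finset.sum_mul]
    refine Finset.sum_congr rfl fun i _ => ?_
    simp only [Finset.mul_sum]
  rw [h4]
  have h5 : ∀ a, (∑ b, (∑ i, chartJacobian e' e i a x * chartJacobian e e' b i x) *
      ∑ c, ∑ d, chartJacobian e e' c j x * chartJacobian e e' d k x *
      coordForm e a x (α.curvature (coordField e b) (coordField e c) (coordField e d) x)) =
      ∑ c, ∑ d, chartJacobian e e' c j x * chartJacobian e e' d k x *
      coordForm e a x (α.curvature (coordField e a) (coordField e c) (coordField e d) x) := by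
    intro a
    simp only [h2]
    rw [Finset.sum_eq_single a (fun b _ hb => by rw [if_neg hb, zero_mul]) (by simp), if_pos rfl,
      one_mul]
  rw [Finset.sum_congr rfl fun a _ => h5 a]
  simp only [ricci, Finset.mul_sum]
  rw [Finset.sum_comm]
  exact Finset.sum_congr rfl fun c _ => Finset.sum_comm

/-- The projective Schouten tensor is a tensor. -/
theorem schouten_change (he : e ∈ IsManifold.maximalAtlas (𝓡∂ (m + 1)) ∞ M)
    (hx : x ∈ e.source) (he' : e' ∈ IsManifold.maximalAtlas (𝓡∂ (m + 1)) ∞ M)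
    (hx' : x ∈ e'.source) (j k : Fin (m + 1)) :
    α.schouten e' j k x =
      ∑ c, ∑ d, chartJacobian e e' c j x * chartJacobian e e' d k x * α.schouten e c d x := by
  have h : α.ricci e' k j x =
      ∑ c, ∑ d, chartJacobian e e' c j x * chartJacobian e e' d k x * α.ricci e d c x := by
    rw [α.ricci_change he hx he' hx', Finset.sum_comm]
    refine Finset.sum_congr rfl fun c _ => Finset.sum_congr rfl fun d _ => by ring
  simp only [schouten]
  rw [h, α.ricci_change he hx he' hx', ← Finset.sum_sub_distrib, Finset.sum_div, Finset.mul_sum,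
    ← Finset.sum_sub_distrib, Finset.sum_div]
  refine Finset.sum_congr rfl fun c _ => ?_
  rw [← Finset.sum_sub_distrib, Finset.sum_div, Finset.mul_sum,
    ← Finset.sum_sub_distrib, Finset.sum_div]
  refine Finset.sum_congr rfl fun d _ => ?_
  ring

end TorsionFreeConnection

end Charts

theorem Filter.EventuallyEq.mvfderiv_eq {E : Type*} [NormedAddCommGroup E] [NormedSpace ℝ E]
    {H : Type*} [TopologicalSpace H] {I : ModelWithCorners ℝ E H} {N : Type*} [TopologicalSpace N]
    [ChartedSpace H N] {f g : N → ℝ} {x : N} (h : f =ᶠ[𝓝 x] g) :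
    mvfderiv I f x = mvfderiv I g x := by
  ext v
  simp only [mvfderiv, h.mfderiv_eq]
  rfl

theorem mvfderiv_apply_eq_zero {E : Type*} [NormedAddCommGroup E] [NormedSpace ℝ E]
    {H : Type*} [TopologicalSpace H] {I : ModelWithCorners ℝ E H} {N : Type*} [TopologicalSpace N]
    [ChartedSpace H N] {f : N → ℝ} {x : N} (h : f =ᶠ[𝓝 x] fun _ => 0) (v : TangentSpace I x) :
    mvfderiv I f x v = 0 := by
  rw [h.mvfderiv_eq, mvfderiv_const]
  rfl

/-! ### Vectors tangent to the boundary, and the totally geodesic condition. -/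

section BoundaryGeometry

variable {m : ℕ} {M : Type*} [TopologicalSpace M] [ChartedSpace (EuclideanHalfSpace (m + 1)) M]
  {e e' e'' : OpenPartialHomeomorph M (EuclideanHalfSpace (m + 1))}

/-- Every boundary chart maps the boundary to `{r = 0}`. -/
theorem chart_zero_eq_zero_of_mem_boundary (he : e ∈ IsManifold.maximalAtlas (𝓡∂ (m + 1)) ∞ M)
    {x : M} (hx : x ∈ e.source) (hb : x ∈ (𝓡∂ (m + 1)).boundary M) : (e x).val 0 = 0 := by
  -- If `r > 0`, the image is an interior point of the half-space. The inverse chart has surjective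
  -- differential, hence carries interior points to interior points, and `x` would be interior.
  by_contra h
  have hpos : 0 < (e x).val 0 := lt_of_le_of_ne (e x).property (Ne.symm h)
  have hmd : e.MDifferentiable (𝓡∂ (m + 1)) (𝓡∂ (m + 1)) :=
    ⟨(contMDiffOn_of_mem_maximalAtlas he).mdifferentiableOn (by simp),
      (contMDiffOn_symm_of_mem_maximalAtlas he).mdifferentiableOn (by simp)⟩
  have hx' := e.map_source hx
  have h1 : (𝓡∂ (m + 1)).IsInteriorPoint (e x) := by
    rw [ModelWithCorners.isInteriorPoint_iff]
    refine (chartAt _ (e x)).mem_interior_extend_target (by simp) ?_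
    rw [interior_range_modelWithCornersEuclideanHalfSpace]
    exact hpos
  have h2 := (hmd.mdifferentiableAt_symm hx').isInteriorPoint_of_surjective_mfderiv
    (hmd.symm.mfderiv_surjective hx') h1
  rw [e.left_inv hx] at h2
  exact ((𝓡∂ (m + 1)).isBoundaryPoint_iff_not_isInteriorPoint x).1 hb h2

theorem eventually_mem_source {x : Bdry m M} (hx : x.val ∈ e.source) :
    ∀ᶠ y : Bdry m M in 𝓝 x, y.val ∈ e.source :=
  continuous_subtype_val.continuousAt.eventually (e.open_source.mem_nhds hx)

variable [IsManifold (𝓡∂ (m + 1)) ∞ M]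

-- In the preferred charts the inclusion reads `y ↦ (0, y)`.
variable (m M) in
theorem contMDiff_boundary_val :
    ContMDiff (𝓡 m) (𝓡∂ (m + 1)) ∞ (Subtype.val : Bdry m M → M) := by
  intro x
  rw [contMDiffAt_iff]
  refine ⟨continuous_subtype_val.continuousAt, ?_⟩
  have hc := chart_mem_atlas (EuclideanHalfSpace (m + 1)) x.val
  have hx : x ∈ (chartAt (EuclideanSpace ℝ (Fin m)) x).source := mem_chart_source _ x
  have h1 : (chartAt (EuclideanSpace ℝ (Fin m)) x).target ∈
      𝓝 (chartAt (EuclideanSpace ℝ (Fin m)) x x) :=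
    (chartAt (EuclideanSpace ℝ (Fin m)) x).open_target.mem_nhds
      ((chartAt (EuclideanSpace ℝ (Fin m)) x).map_source hx)
  refine ContDiffAt.contDiffWithinAt ?_
  refine (contDiff_zeroCons_val (m := m)).contDiffAt.congr_of_eventuallyEq ?_
  filter_upwards [h1] with y hy
  have hy' : zeroCons y ∈ (chartAt (EuclideanHalfSpace (m + 1)) x.val).target := hy
  change (chartAt (EuclideanHalfSpace (m + 1)) x.val
    ((boundaryChart (chartAt _ x.val) hc x).symm y).val).val = (zeroCons y).val
  rw [boundaryChart_symm_val _ hc x hy', (chartAt _ x.val).right_inv hy']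

/-- The differential of the inclusion of the boundary. -/
noncomputable def boundaryDeriv (x : Bdry m M) :
    TangentSpace (𝓡 m) x →L[ℝ] TangentSpace (𝓡∂ (m + 1)) x.val :=
  mfderiv (𝓡 m) (𝓡∂ (m + 1)) (Subtype.val : Bdry m M → M) x

theorem mdifferentiableAt_boundary_val (x : Bdry m M) :
    MDifferentiableAt (𝓡 m) (𝓡∂ (m + 1)) (Subtype.val : Bdry m M → M) x :=
  (contMDiff_boundary_val m M x).mdifferentiableAt (by simp)

theorem mvfderiv_boundaryDeriv {f : M → ℝ} {x : Bdry m M}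
    (hf : SmoothFnAt (𝓡∂ (m + 1)) f x.val) (v : TangentSpace (𝓡 m) x) :
    mvfderiv (𝓡∂ (m + 1)) f x.val (boundaryDeriv x v) =
      mvfderiv (𝓡 m) (fun y : Bdry m M => f y.val) x v :=
  (mvfderiv_comp_apply x hf.mdifferentiableAt (mdifferentiableAt_boundary_val x) v).symm

theorem SmoothFnAt.comp_boundary_val {f : M → ℝ} {x : Bdry m M}
    (hf : SmoothFnAt (𝓡∂ (m + 1)) f x.val) :
    SmoothFnAt (𝓡 m) (fun y : Bdry m M => f y.val) x := by
  filter_upwards [continuous_subtype_val.continuousAt.eventually hf] with y hy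
  exact ContMDiffAt.comp y hy (contMDiff_boundary_val m M y)

/-- The coordinate `r` restricts to zero on the boundary part of the chart domain, so its tangential
derivative is zero. -/
theorem coordForm_zero_boundaryDeriv (he : e ∈ IsManifold.maximalAtlas (𝓡∂ (m + 1)) ∞ M)
    {x : Bdry m M} (hx : x.val ∈ e.source) (v : TangentSpace (𝓡 m) x) :
    coordForm e 0 x.val (boundaryDeriv x v) = 0 := by
  rw [coordForm_eq_mvfderiv he hx, mvfderiv_boundaryDeriv (smoothFnAt_coord he hx 0)]
  have h : (fun y : Bdry m M => e.extend (𝓡∂ (m + 1)) y.val 0) =ᶠ[𝓝 x] fun _ => 0 := by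
    filter_upwards [eventually_mem_source hx] with y hy
    exact chart_zero_eq_zero_of_mem_boundary he hy y.property
  exact mvfderiv_apply_eq_zero h v

/-- The boundary chart is the inclusion followed by a chart of `M` and the projection `T` that drops
`r`. Its differential is invertible and factors through `boundaryDeriv x`. -/
theorem boundaryDeriv_injective (x : Bdry m M) : Function.Injective (boundaryDeriv x) := by
  let T : EuclideanSpace ℝ (Fin (m + 1)) →L[ℝ] EuclideanSpace ℝ (Fin m) :=
    LinearMap.toContinuousLinearMap
      { toFun := fun z => WithLp.toLp 2 fun μ => z μ.succ
        map_add' := fun _ _ => rfl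
        map_smul' := fun _ _ => rfl }
  have hinv := isInvertible_mfderiv_extChartAt (I := 𝓡 m) (mem_extChartAt_source (I := 𝓡 m) x)
  have hfun : (extChartAt (𝓡 m) x : Bdry m M → EuclideanSpace ℝ (Fin m)) =
      (T ∘ (chartAt _ x.val).extend (𝓡∂ (m + 1))) ∘ Subtype.val := rfl
  have hchart := ((chartAt (EuclideanHalfSpace (m + 1)) x.val).contMDiffAt_extend
    (IsManifold.chart_mem_maximalAtlas (I := 𝓡∂ (m + 1)) (n := ∞) x.val)
    (mem_chart_source _ x.val)).mdifferentiableAt (by simp)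
  have hT := T.differentiableAt.mdifferentiableAt.comp x.val hchart
  have hcomp := mfderiv_comp x hT (mdifferentiableAt_boundary_val x)
  rw [← hfun] at hcomp
  intro v w hvw
  refine hinv.injective ?_
  rw [hcomp]
  exact congrArg (mfderiv (𝓡∂ (m + 1)) 𝓘(ℝ, EuclideanSpace ℝ (Fin m)) _ x.val) hvw

/-- The tangential coordinate forms, restricted to the boundary, form a basis of the cotangent
space. -/
theorem bijective_coordForm_succ_boundaryDeriv
    (he : e ∈ IsManifold.maximalAtlas (𝓡∂ (m + 1)) ∞ M) {x : Bdry m M} (hx : x.val ∈ e.source) :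
    Function.Bijective (fun (v : TangentSpace (𝓡 m) x) (μ : Fin m) =>
      coordForm e μ.succ x.val (boundaryDeriv x v)) := by
  let L : EuclideanSpace ℝ (Fin m) →ₗ[ℝ] (Fin m → ℝ) :=
    LinearMap.pi fun μ => ((coordForm e μ.succ x.val) ∘L (boundaryDeriv x)).toLinearMap
  have hinj : Function.Injective L := by
    rw [injective_iff_map_eq_zero]
    intro v hv
    have h1 : boundaryDeriv x v = boundaryDeriv x 0 := by
      refine ext_coordForm he hx (Fin.cases ?_ fun μ => ?_)
      · exact (coordForm_zero_boundaryDeriv he hx v).trans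
          (coordForm_zero_boundaryDeriv he hx 0).symm
      · rw [map_zero, map_zero]
        exact congrFun hv μ
    exact boundaryDeriv_injective x h1
  exact ⟨hinj, (LinearMap.injective_iff_surjective_of_finrank_eq_finrank (by simp)).1 hinj⟩

/-- The fields `∂/∂y^μ` are tangent to the boundary; through this, the vanishing of `dr` on tangent
vectors becomes the vanishing of Jacobian entries. -/
theorem exists_boundaryDeriv_eq_coordField (he : e ∈ IsManifold.maximalAtlas (𝓡∂ (m + 1)) ∞ M)
    {x : Bdry m M} (hx : x.val ∈ e.source) (μ : Fin m) :
    ∃ t : TangentSpace (𝓡 m) x, boundaryDeriv x t = coordField e μ.succ x.val := by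
  obtain ⟨t, ht⟩ := (bijective_coordForm_succ_boundaryDeriv he hx).2 (Pi.single μ 1)
  refine ⟨t, ext_coordForm he hx (Fin.cases ?_ fun ν => ?_)⟩
  · rw [coordForm_zero_boundaryDeriv he hx, coordForm_coordField he hx,
      if_neg (Fin.succ_ne_zero μ).symm]
  · rw [coordForm_coordField he hx]
    refine (congrFun ht ν).trans ?_
    simp [Pi.single_apply]

theorem chartJacobian_zero_succ (he : e ∈ IsManifold.maximalAtlas (𝓡∂ (m + 1)) ∞ M)
    (he' : e' ∈ IsManifold.maximalAtlas (𝓡∂ (m + 1)) ∞ M) {x : Bdry m M} (hx : x.val ∈ e.source)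
    (hx' : x.val ∈ e'.source) (μ : Fin m) : chartJacobian e e' 0 μ.succ x.val = 0 := by
  obtain ⟨t, ht⟩ := exists_boundaryDeriv_eq_coordField he' hx' μ
  rw [chartJacobian, ← ht, coordForm_zero_boundaryDeriv he hx]

/-- The entry vanishes along the boundary near `x`, not merely at `x`, so its derivatives in
tangential directions vanish too. -/
theorem mvfderiv_chartJacobian_zero_succ (he : e ∈ IsManifold.maximalAtlas (𝓡∂ (m + 1)) ∞ M)
    (he' : e' ∈ IsManifold.maximalAtlas (𝓡∂ (m + 1)) ∞ M) {x : Bdry m M} (hx : x.val ∈ e.source)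
    (hx' : x.val ∈ e'.source) (μ : Fin m) (v : TangentSpace (𝓡 m) x) :
    mvfderiv (𝓡∂ (m + 1)) (chartJacobian e e' 0 μ.succ) x.val (boundaryDeriv x v) = 0 := by
  rw [mvfderiv_boundaryDeriv (smoothFnAt_chartJacobian he hx he' hx' 0 μ.succ)]
  have h : (fun y : Bdry m M => chartJacobian e e' 0 μ.succ y.val) =ᶠ[𝓝 x] fun _ => 0 := by
    filter_upwards [eventually_mem_source hx, eventually_mem_source hx'] with y hy hy'
    exact chartJacobian_zero_succ he he' hy hy' μ
  exact mvfderiv_apply_eq_zero h v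

/-- The tangential blocks of the Jacobians compose at boundary points. -/
theorem sum_chartJacobian_succ_mul (he' : e' ∈ IsManifold.maximalAtlas (𝓡∂ (m + 1)) ∞ M)
    (he'' : e'' ∈ IsManifold.maximalAtlas (𝓡∂ (m + 1)) ∞ M) {x : Bdry m M}
    (hx' : x.val ∈ e'.source) (hx'' : x.val ∈ e''.source) (μ ν : Fin m) :
    ∑ κ : Fin m, chartJacobian e e' μ.succ κ.succ x.val * chartJacobian e' e'' κ.succ ν.succ x.val =
      chartJacobian e e'' μ.succ ν.succ x.val := by
  rw [← sum_chartJacobian_mul he' hx', Fin.sum_univ_succ,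
    chartJacobian_zero_succ he' he'' hx' hx'', mul_zero, zero_add]

theorem coordForm_succ_boundaryDeriv_change (he : e ∈ IsManifold.maximalAtlas (𝓡∂ (m + 1)) ∞ M)
    {x : Bdry m M} (hx : x.val ∈ e.source) (μ : Fin m) (v : TangentSpace (𝓡 m) x) :
    coordForm e' μ.succ x.val (boundaryDeriv x v) = ∑ κ : Fin m,
      chartJacobian e' e μ.succ κ.succ x.val * coordForm e κ.succ x.val (boundaryDeriv x v) := by
  rw [coordForm_eq_sum_chartJacobian he hx, Fin.sum_univ_succ,
    coordForm_zero_boundaryDeriv he hx, mul_zero, zero_add]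

namespace TorsionFreeConnection

variable (α β : TorsionFreeConnection m M)

/-- In the transformation law the outer sum keeps only the index `0`. There the inhomogeneous term
and the `α^0_0` term contain `∂r/∂y'^μ` or its tangential derivative, and the others contain
`α^0_l(v)`, zero by assumption. -/
theorem connForm_zero_succ_boundaryDeriv_of_chart
    (he : e ∈ IsManifold.maximalAtlas (𝓡∂ (m + 1)) ∞ M)
    (he' : e' ∈ IsManifold.maximalAtlas (𝓡∂ (m + 1)) ∞ M) {x : Bdry m M} (hx : x.val ∈ e.source)
    (hx' : x.val ∈ e'.source) (v : TangentSpace (𝓡 m) x)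
    (h : ∀ μ : Fin m, α.connForm e 0 μ.succ x.val (boundaryDeriv x v) = 0) (μ : Fin m) :
    α.connForm e' 0 μ.succ x.val (boundaryDeriv x v) = 0 := by
  rw [α.connForm_change he hx he' hx', Fin.sum_univ_succ]
  simp only [Fin.sum_univ_succ (n := m), chartJacobian_zero_succ he' he hx' hx,
    chartJacobian_zero_succ he he' hx hx', h, mvfderiv_chartJacobian_zero_succ he he' hx hx']
  simp

/-- The connections differ by `Υ(v) ∂_μ + Υ(∂_μ) v`, and `dr` kills both `∂_μ` and the tangential
vector `v`. -/
theorem connForm_eq_of_projectivelyEquivalent (h : ProjectivelyEquivalent α β)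
    (he : e ∈ IsManifold.maximalAtlas (𝓡∂ (m + 1)) ∞ M) {x : Bdry m M} (hx : x.val ∈ e.source)
    (v : TangentSpace (𝓡 m) x) (μ : Fin m) :
    β.connForm e 0 μ.succ x.val (boundaryDeriv x v) =
      α.connForm e 0 μ.succ x.val (boundaryDeriv x v) := by
  obtain ⟨Υ, -, hΥ⟩ := h
  have h1 := hΥ (coordField e μ.succ) x.val
    (smoothFieldAt_coordField he hx μ.succ).mdifferentiableAt (boundaryDeriv x v)
  change coordForm e 0 x.val (β.cov (coordField e μ.succ) x.val (boundaryDeriv x v)) =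
    coordForm e 0 x.val (α.cov (coordField e μ.succ) x.val (boundaryDeriv x v))
  rw [h1, map_add, map_add, map_smul, map_smul, coordForm_zero_boundaryDeriv he hx,
    coordForm_coordField he hx, if_neg (Fin.succ_ne_zero μ).symm]
  simp

/-- Under the non-rigidity condition, the boundary is totally geodesic for every connection of the
projective structure. -/
theorem connForm_zero_succ_boundaryDeriv {P : ProjectiveStructure m M} (hP : P.IsNonRigid)
    (hα : (⟦α⟧ : ProjectiveStructure m M) = P) (he : e ∈ IsManifold.maximalAtlas (𝓡∂ (m + 1)) ∞ M)
    {x : Bdry m M} (hx : x.val ∈ e.source) (v : TangentSpace (𝓡 m) x) (μ : Fin m) :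
    α.connForm e 0 μ.succ x.val (boundaryDeriv x v) = 0 := by
  -- The chart and the connection supplied here may vary with the point: pass from `β` to `α` inside
  -- `e₀`, then from `e₀` to `e`.
  obtain ⟨e₀, he₀, hx₀, β, hβ, h⟩ := hP x.val x.property
  have hβα : ProjectivelyEquivalent β α := Quotient.exact (hβ.trans hα.symm)
  refine α.connForm_zero_succ_boundaryDeriv_of_chart he₀ he hx₀ hx v (fun ν => ?_) μ
  rw [connForm_eq_of_projectivelyEquivalent β α hβα he₀ hx₀]
  obtain ⟨c, hc⟩ := Submodule.mem_span_singleton.1 (h ν)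
  rw [← hc]
  change c * coordForm e₀ 0 x.val (boundaryDeriv x v) = 0
  rw [coordForm_zero_boundaryDeriv he₀ hx₀, mul_zero]

/-- The transformation law of the connection induced on a totally geodesic boundary. -/
theorem connForm_succ_boundaryDeriv_change (he : e ∈ IsManifold.maximalAtlas (𝓡∂ (m + 1)) ∞ M)
    (he' : e' ∈ IsManifold.maximalAtlas (𝓡∂ (m + 1)) ∞ M) {x : Bdry m M} (hx : x.val ∈ e.source)
    (hx' : x.val ∈ e'.source) (v : TangentSpace (𝓡 m) x)
    (h : ∀ μ : Fin m, α.connForm e 0 μ.succ x.val (boundaryDeriv x v) = 0) (μ ν : Fin m) :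
    α.connForm e' μ.succ ν.succ x.val (boundaryDeriv x v) =
      ∑ κ : Fin m, chartJacobian e' e μ.succ κ.succ x.val *
        (mvfderiv (𝓡 m) (fun y : Bdry m M => chartJacobian e e' κ.succ ν.succ y.val) x v +
          ∑ l : Fin m, α.connForm e κ.succ l.succ x.val (boundaryDeriv x v) *
            chartJacobian e e' l.succ ν.succ x.val) := by
  -- Every contribution of the index `0` carries `∂r/∂y'^ν`, its tangential derivative, or
  -- `α^0_l(v)`, so only tangential indices survive.
  rw [α.connForm_change he hx he' hx', Fin.sum_univ_succ]
  simp only [Fin.sum_univ_succ (n := m), chartJacobian_zero_succ he he' hx hx', h,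
    mvfderiv_chartJacobian_zero_succ he he' hx hx',
    mvfderiv_boundaryDeriv (smoothFnAt_chartJacobian he hx he' hx' _ _)]
  simp

theorem schouten_succ_change [T2Space M] (he : e ∈ IsManifold.maximalAtlas (𝓡∂ (m + 1)) ∞ M)
    (he' : e' ∈ IsManifold.maximalAtlas (𝓡∂ (m + 1)) ∞ M) {x : Bdry m M} (hx : x.val ∈ e.source)
    (hx' : x.val ∈ e'.source) (μ ν : Fin m) :
    α.schouten e' μ.succ ν.succ x.val = ∑ κ : Fin m, ∑ l : Fin m,
      chartJacobian e e' κ.succ μ.succ x.val * chartJacobian e e' l.succ ν.succ x.val *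
        α.schouten e κ.succ l.succ x.val := by
  rw [α.schouten_change he hx he' hx', Fin.sum_univ_succ]
  simp only [Fin.sum_univ_succ (n := m), chartJacobian_zero_succ he he' hx hx']
  simp

end TorsionFreeConnection

end BoundaryGeometry

/-! ### Matrix representatives for the isotropy group and for `𝔭𝔤𝔩`. -/

section ProjectiveGroup

variable {m : ℕ}

theorem mk_mem_isotropyGroup_iff {g : GL (HIdx m) ℝ} :
    Matrix.ProjGenLinGroup.mk g ∈ isotropyGroup m ↔ ∀ μ, g.val (Sum.inl μ) (Sum.inr ()) = 0 := by
  have hcol : g • (Pi.single (Sum.inr ()) 1 : HIdx m → ℝ) = fun i => g.val i (Sum.inr ()) := by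
    change g.val.mulVec _ = _
    ext i
    simp
  rw [isotropyGroup, MulAction.mem_stabilizer_iff, basePoint, Projectivization.PGL.mk_smul_mk,
    Projectivization.mk_eq_mk_iff', hcol]
  constructor
  · rintro ⟨a, ha⟩ μ
    simpa using (congrFun ha (Sum.inl μ)).symm
  · intro h
    refine ⟨g.val (Sum.inr ()) (Sum.inr ()), ?_⟩
    ext i
    rcases i with μ | u
    · simp [h μ]
    · simp

theorem adPGL_mk_mk (g : GL (HIdx m) ℝ) (X : Matrix (HIdx m) (HIdx m) ℝ) :
    adPGL (HIdx m) (Matrix.ProjGenLinGroup.mk g) (Pgl.mk X) = Pgl.mk (g.val * X * g⁻¹.val) :=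
  rfl

theorem Pgl.mk_eq_mk_iff {X Y : Matrix (HIdx m) (HIdx m) ℝ} :
    Pgl.mk X = Pgl.mk Y ↔ ∃ c : ℝ, X = Y + c • (1 : Matrix (HIdx m) (HIdx m) ℝ) := by
  have h : Pgl.mk X = Pgl.mk Y ↔ X - Y ∈ (scalarIdeal (HIdx m)).toSubmodule :=
    Submodule.Quotient.eq _
  rw [h]
  constructor
  · rintro ⟨c, hc⟩
    exact ⟨c, by rw [← hc, add_sub_cancel]⟩
  · rintro ⟨c, hc⟩
    exact ⟨c, by rw [hc, add_sub_cancel_left]⟩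

theorem Pgl.mk_surjective (Z : Pgl (HIdx m)) : ∃ X : Matrix (HIdx m) (HIdx m) ℝ, Pgl.mk X = Z :=
  Submodule.Quotient.mk_surjective _ Z

end ProjectiveGroup

/-! ### Entrywise calculus of matrix-valued functions. -/

section MatrixFunctions

variable {E : Type*} [NormedAddCommGroup E] [NormedSpace ℝ E]
  {H : Type*} [TopologicalSpace H] {I : ModelWithCorners ℝ E H}
  {N : Type*} [TopologicalSpace N] [ChartedSpace H N]
  {ι : Type*} {G G' : N → Matrix ι ι ℝ} {x : N} {W : Set N}

variable (I) in
/-- The derivative of a matrix-valued function, entry by entry. -/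
noncomputable def matrixDeriv (G : N → Matrix ι ι ℝ) (x : N) (v : TangentSpace I x) :
    Matrix ι ι ℝ :=
  Matrix.of fun a b => mvfderiv I (fun y => G y a b) x v

theorem matrixDeriv_congr (h : G =ᶠ[𝓝 x] G') (v : TangentSpace I x) :
    matrixDeriv I G x v = matrixDeriv I G' x v := by
  ext a b
  have h' : (fun y => G y a b) =ᶠ[𝓝 x] fun y => G' y a b := by
    filter_upwards [h] with y hy
    rw [hy]
  exact DFunLike.congr_fun h'.mvfderiv_eq v

theorem matrixDeriv_const (A : Matrix ι ι ℝ) (v : TangentSpace I x) :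
    matrixDeriv I (fun _ => A) x v = 0 := by
  ext a b
  simp [matrixDeriv, mvfderiv_const]

theorem mvfderiv_sum_apply {κ : Type*} (s : Finset κ) {F : κ → N → ℝ}
    (hF : ∀ i ∈ s, MDifferentiableAt I 𝓘(ℝ, ℝ) (F i) x) (v : TangentSpace I x) :
    MDifferentiableAt I 𝓘(ℝ, ℝ) (fun y => ∑ i ∈ s, F i y) x ∧
    mvfderiv I (fun y => ∑ i ∈ s, F i y) x v = ∑ i ∈ s, mvfderiv I (F i) x v := by
  classical
  induction s using Finset.induction_on with
  | empty => simp [mdifferentiableAt_const, mvfderiv_const]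
  | insert a s ha ih =>
    obtain ⟨h1, h2⟩ := ih fun i hi => hF i (Finset.mem_insert_of_mem hi)
    have h3 := hF a (Finset.mem_insert_self a s)
    simp only [Finset.sum_insert ha]
    refine ⟨h3.add h1, ?_⟩
    rw [← h2]
    exact DFunLike.congr_fun (mvfderiv_add h3 h1) v

variable [Fintype ι]

theorem matrixDeriv_mul (hG : ∀ a b, MDifferentiableAt I 𝓘(ℝ, ℝ) (fun y => G y a b) x)
    (hG' : ∀ a b, MDifferentiableAt I 𝓘(ℝ, ℝ) (fun y => G' y a b) x) (v : TangentSpace I x) :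
    matrixDeriv I (fun y => G y * G' y) x v =
      matrixDeriv I G x v * G' x + G x * matrixDeriv I G' x v := by
  ext a b
  simp only [matrixDeriv, Matrix.of_apply, Matrix.add_apply, Matrix.mul_apply]
  refine (mvfderiv_sum_apply Finset.univ (fun c _ => (hG a c).mul (hG' c b)) v).2.trans ?_
  rw [← Finset.sum_add_distrib]
  refine Finset.sum_congr rfl fun c _ => ?_
  have h := DFunLike.congr_fun (mvfderiv_mul (hG a c) (hG' c b)) v
  refine h.trans ?_
  simp only [add_apply, smul_apply, smul_eq_mul]
  ring

theorem contMDiffOn_matrix_mul (hG : ∀ a b, ContMDiffOn I 𝓘(ℝ, ℝ) ∞ (fun y => G y a b) W)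
    (hG' : ∀ a b, ContMDiffOn I 𝓘(ℝ, ℝ) ∞ (fun y => G' y a b) W) (a b : ι) :
    ContMDiffOn I 𝓘(ℝ, ℝ) ∞ (fun y => (G y * G' y) a b) W := by
  simp only [Matrix.mul_apply]
  exact contMDiffOn_finsetSum fun c _ => (hG a c).mul (hG' c b)

variable [DecidableEq ι]

theorem contMDiffOn_matrix_det (hG : ∀ a b, ContMDiffOn I 𝓘(ℝ, ℝ) ∞ (fun y => G y a b) W) :
    ContMDiffOn I 𝓘(ℝ, ℝ) ∞ (fun y => (G y).det) W := by
  simp only [Matrix.det_apply']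
  exact contMDiffOn_finsetSum fun σ _ => contMDiffOn_const.mul
    (contMDiffOn_finsetProd fun c _ => hG _ _)

/-- By Cramer's rule the entries of the inverse are determinants in the entries of `g`, divided by
the nonvanishing determinant of `g`. -/
theorem contMDiffOn_GL_inv {g : N → GL ι ℝ}
    (hg : ∀ a b, ContMDiffOn I 𝓘(ℝ, ℝ) ∞ (fun y => (g y).val a b) W) (a b : ι) :
    ContMDiffOn I 𝓘(ℝ, ℝ) ∞ (fun y => (g y)⁻¹.val a b) W := by
  have h1 : ∀ y, (g y)⁻¹.val a b = ((g y).val.det)⁻¹ * (g y).val.adjugate a b := by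
    intro y
    rw [Matrix.coe_units_inv, Matrix.inv_def, Ring.inverse_eq_inv]
    rfl
  simp only [h1, Matrix.adjugate_apply]
  refine ContMDiffOn.mul ((contMDiffOn_matrix_det hg).inv₀ fun y _ => ?_)
    (contMDiffOn_matrix_det fun c d => ?_)
  · exact (Matrix.isUnits_det_units (g y)).ne_zero
  · by_cases hc : c = b
    · subst hc
      simpa using contMDiffOn_const
    · simpa [Matrix.updateRow_ne hc] using hg c d

/-- Differentiate `g⁻¹ g = 1`. -/
theorem matrixDeriv_GL_inv {g : N → GL ι ℝ}
    (hg : ∀ a b, ContMDiffOn I 𝓘(ℝ, ℝ) ∞ (fun y => (g y).val a b) W) (hW : W ∈ 𝓝 x)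
    (v : TangentSpace I x) :
    matrixDeriv I (fun y => (g y)⁻¹.val) x v =
      -((g x)⁻¹.val * matrixDeriv I (fun y => (g y).val) x v * (g x)⁻¹.val) := by
  have hd : ∀ a b, MDifferentiableAt I 𝓘(ℝ, ℝ) (fun y => (g y).val a b) x := fun a b =>
    ((hg a b).contMDiffAt hW).mdifferentiableAt (by simp)
  have hd' : ∀ a b, MDifferentiableAt I 𝓘(ℝ, ℝ) (fun y => (g y)⁻¹.val a b) x := fun a b =>
    ((contMDiffOn_GL_inv hg a b).contMDiffAt hW).mdifferentiableAt (by simp)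
  have h1 := matrixDeriv_mul hd' hd v
  simp only [Units.inv_mul] at h1
  rw [matrixDeriv_const] at h1
  have h2 := congrArg (· * (g x)⁻¹.val) h1
  simp only [zero_mul, add_mul, mul_assoc, Units.mul_inv, mul_one] at h2
  rw [mul_assoc]
  exact eq_neg_of_add_eq_zero_left h2.symm

end MatrixFunctions

/-! ### Transition maps, their uniqueness, and the maximal Cartan atlas. -/

section CartanAtlas

variable {m : ℕ} {N : Type*} [TopologicalSpace N] [ChartedSpace (EuclideanSpace ℝ (Fin m)) N]
  {h h' : N → PGL(HIdx m, ℝ)} {x : N} {D D' : TangentSpace (𝓡 m) x →ₗ[ℝ] Pgl (HIdx m)}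
  {θ θ' θ'' : LocalForm m N}

theorem HasMaurerCartanAt.congr (hD : HasMaurerCartanAt h x D) (hh : h' =ᶠ[𝓝 x] h) :
    HasMaurerCartanAt h' x D := by
  obtain ⟨W, hW, g, h1, h2, h3⟩ := hD
  refine ⟨W ∩ {y | h' y = h y}, Filter.inter_mem hW hh, g,
    fun a b => (h1 a b).mono inter_subset_left, fun y hy => ?_, h3⟩
  rw [h2 y hy.1, show h' y = h y from hy.2]

/-- The Leibniz rule on local lifts: `(g g')⁻¹ d(g g') = g'⁻¹ dg' + g'⁻¹ (g⁻¹ dg) g'`. -/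
theorem HasMaurerCartanAt.mul (hD : HasMaurerCartanAt h x D) (hD' : HasMaurerCartanAt h' x D') :
    HasMaurerCartanAt (fun y => h y * h' y) x (D' + adPGL (HIdx m) (h' x)⁻¹ ∘ₗ D) := by
  obtain ⟨W, hW, g, h1, h2, h3⟩ := hD
  obtain ⟨W', hW', g', h1', h2', h3'⟩ := hD'
  have s1 : ∀ a b, ContMDiffOn (𝓡 m) 𝓘(ℝ, ℝ) ∞ (fun y => (g y).val a b) (W ∩ W') :=
    fun a b => (h1 a b).mono inter_subset_left
  have s1' : ∀ a b, ContMDiffOn (𝓡 m) 𝓘(ℝ, ℝ) ∞ (fun y => (g' y).val a b) (W ∩ W') :=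
    fun a b => (h1' a b).mono inter_subset_right
  refine ⟨W ∩ W', Filter.inter_mem hW hW', fun y => g y * g' y, contMDiffOn_matrix_mul s1 s1',
    fun y hy => ?_, fun v => ?_⟩
  · rw [map_mul, h2 y hy.1, h2' y hy.2]
  · have hd := matrixDeriv_mul
      (fun a b => ((h1 a b).contMDiffAt hW).mdifferentiableAt (by simp))
      (fun a b => ((h1' a b).contMDiffAt hW').mdifferentiableAt (by simp)) v
    have e1 : D v = Pgl.mk ((g x)⁻¹.val * matrixDeriv (𝓡 m) (fun y => (g y).val) x v) := h3 v
    have e2 : D' v = Pgl.mk ((g' x)⁻¹.val * matrixDeriv (𝓡 m) (fun y => (g' y).val) x v) := h3' v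
    change D' v + adPGL (HIdx m) (h' x)⁻¹ (D v) = Pgl.mk ((g x * g' x)⁻¹.val *
      matrixDeriv (𝓡 m) (fun y => (g y).val * (g' y).val) x v)
    rw [hd, e1, e2, ← h2' x (mem_of_mem_nhds hW'), ← map_inv, adPGL_mk_mk, ← map_add, inv_inv,
      mul_inv_rev, Units.val_mul]
    congr 1
    rw [mul_add, add_comm]
    congr 1
    · noncomm_ring
    · rw [mul_assoc, ← mul_assoc (g x)⁻¹.val, Units.inv_mul, one_mul]

theorem HasMaurerCartanAt.inv (hD : HasMaurerCartanAt h x D) :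
    HasMaurerCartanAt (fun y => (h y)⁻¹) x (-(adPGL (HIdx m) (h x) ∘ₗ D)) := by
  obtain ⟨W, hW, g, h1, h2, h3⟩ := hD
  refine ⟨W, hW, fun y => (g y)⁻¹, contMDiffOn_GL_inv h1, fun y hy => ?_, fun v => ?_⟩
  · rw [map_inv, h2 y hy]
  · have e1 : D v = Pgl.mk ((g x)⁻¹.val * matrixDeriv (𝓡 m) (fun y => (g y).val) x v) := h3 v
    change -(adPGL (HIdx m) (h x) (D v)) = Pgl.mk ((g x)⁻¹⁻¹.val *
      matrixDeriv (𝓡 m) (fun y => (g y)⁻¹.val) x v)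
    rw [matrixDeriv_GL_inv h1 hW, e1, ← h2 x (mem_of_mem_nhds hW), adPGL_mk_mk, ← map_neg]
    simp only [inv_inv, mul_neg, mul_assoc]

/-- `h` satisfies the conditions on a transition map from `θ` to `θ'` at `x`. -/
def LocalForm.IsTransitionAt (θ θ' : LocalForm m N) (h : N → PGL(HIdx m, ℝ)) (x : N) : Prop :=
  h x ∈ isotropyGroup m ∧ ∃ D : TangentSpace (𝓡 m) x →ₗ[ℝ] Pgl (HIdx m),
    HasMaurerCartanAt h x D ∧ θ'.form x = D + adPGL (HIdx m) (h x)⁻¹ ∘ₗ θ.form x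

theorem LocalForm.IsTransitionAt.congr (H : θ.IsTransitionAt θ' h x) (hh : h' =ᶠ[𝓝 x] h) :
    θ.IsTransitionAt θ' h' x := by
  obtain ⟨h1, D, hD, h2⟩ := H
  rw [LocalForm.IsTransitionAt, hh.self_of_nhds]
  exact ⟨h1, D, hD.congr hh, h2⟩

theorem LocalForm.IsTransitionAt.mul (H : θ.IsTransitionAt θ' h x)
    (H' : θ'.IsTransitionAt θ'' h' x) : θ.IsTransitionAt θ'' (fun y => h y * h' y) x := by
  obtain ⟨h1, D, hD, h2⟩ := H
  obtain ⟨h1', D', hD', h2'⟩ := H'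
  refine ⟨mul_mem h1 h1', _, hD.mul hD', ?_⟩
  rw [h2', h2, mul_inv_rev, map_mul, Module.End.mul_eq_comp, LinearMap.comp_add, add_assoc]
  rfl

theorem LocalForm.IsTransitionAt.inv (H : θ.IsTransitionAt θ' h x) :
    θ'.IsTransitionAt θ (fun y => (h y)⁻¹) x := by
  obtain ⟨h1, D, hD, h2⟩ := H
  refine ⟨inv_mem h1, _, hD.inv, ?_⟩
  rw [h2, inv_inv, LinearMap.comp_add, ← LinearMap.comp_assoc, ← Module.End.mul_eq_comp, ← map_mul,
    mul_inv_cancel, map_one, Module.End.one_eq_id, LinearMap.id_comp]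
  abel

/-- The self-transition equation, multiplied on the left by a smooth local lift `g` to clear
inverses. The constant `c` is the scalar ambiguity of `𝔭𝔤𝔩` and depends on `v` and `T`. -/
theorem LocalForm.IsTransitionAt.exists_lift {k : N → PGL(HIdx m, ℝ)}
    (H : θ.IsTransitionAt θ k x) :
    ∃ g : N → GL (HIdx m) ℝ, (∀ᶠ y in 𝓝 x, Matrix.ProjGenLinGroup.mk (g y) = k y) ∧
      ∀ v T, θ.form x v = Pgl.mk T → ∃ c : ℝ, (g x).val * T =
        matrixDeriv (𝓡 m) (fun y => (g y).val) x v + T * (g x).val + c • (g x).val := by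
  obtain ⟨h1, D, ⟨W, hW, g, s1, s2, s3⟩, h2⟩ := H
  refine ⟨g, Filter.mem_of_superset hW s2, fun v T hT => ?_⟩
  have e1 : D v = Pgl.mk ((g x)⁻¹.val * matrixDeriv (𝓡 m) (fun y => (g y).val) x v) := s3 v
  have e2 : θ.form x v = D v + adPGL (HIdx m) (k x)⁻¹ (θ.form x v) := DFunLike.congr_fun h2 v
  rw [hT, e1, ← s2 x (mem_of_mem_nhds hW), ← map_inv, adPGL_mk_mk, ← map_add, inv_inv,
    Pgl.mk_eq_mk_iff] at e2
  obtain ⟨c, hc⟩ := e2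
  refine ⟨c, ?_⟩
  conv_lhs => rw [hc]
  rw [mul_add, mul_add, ← mul_assoc, Units.mul_inv, one_mul, ← mul_assoc, ← mul_assoc,
    Units.mul_inv, one_mul, mul_smul_comm, mul_one]

variable [IsManifold (𝓡 m) ∞ N]

/-- Surjectivity onto `𝔤/𝔥`, in matrix terms: the quotient records exactly the upper part of the
last column, so that part can be prescribed at will. -/
theorem LocalForm.IsCartanGauge.exists_form_eq (hθ : θ.IsCartanGauge) (hx : x ∈ θ.dom)
    (w : Fin m → ℝ) : ∃ v T, θ.form x v = Pgl.mk T ∧ ∀ μ, T (Sum.inl μ) (Sum.inr ()) = w μ := by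
  let Z : Matrix (HIdx m) (HIdx m) ℝ := Matrix.of fun i _ => Sum.elim w 0 i
  obtain ⟨v, hv⟩ := (hθ.regular x hx).2 ((isotropyAlgebra m).mkQ (Pgl.mk Z))
  have h1 : θ.form x v - Pgl.mk Z ∈ isotropyAlgebra m := (Submodule.Quotient.eq _).1 hv
  obtain ⟨X, hX, hXe⟩ := h1
  refine ⟨v, Z + X, ?_, fun μ => ?_⟩
  · rw [map_add, hXe, add_sub_cancel]
  · have := hX μ
    simp [Z, this]

/-- Write a lift as `(A, 0; p, s)`. The zero block persists near `x`, so its derivative vanishes,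
and the last column of the self-transition equation reads `A w = s w` for every prescribed `w`.
Hence `A = s I`. -/
theorem LocalForm.IsTransitionAt.isotropy_isScalar {k : N → PGL(HIdx m, ℝ)}
    (hθ : θ.IsCartanGauge) (hx : x ∈ θ.dom) (H : ∀ᶠ y in 𝓝 x, k y ∈ isotropyGroup m)
    (Hx : θ.IsTransitionAt θ k x) {g : GL (HIdx m) ℝ}
    (hg : Matrix.ProjGenLinGroup.mk g = k x) (μ κ : Fin m) :
    g.val (Sum.inl μ) (Sum.inl κ) =
      if μ = κ then g.val (Sum.inr ()) (Sum.inr ()) else 0 := by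
  obtain ⟨γ, h1, h2⟩ := Hx.exists_lift
  -- Lifts of the same class differ by a scalar `u`, and the claim is homogeneous, so it suffices to
  -- treat the smooth lift `γ`.
  obtain ⟨u, rfl⟩ := Matrix.ProjGenLinGroup.mk_eq_mk_iff.1 (h1.self_of_nhds.trans hg.symm)
  have hcol : ∀ᶠ y in 𝓝 x, ∀ ρ, (γ y).val (Sum.inl ρ) (Sum.inr ()) = 0 := by
    filter_upwards [H, h1] with y hy hy1
    rw [← hy1] at hy
    exact mk_mem_isotropyGroup_iff.1 hy
  obtain ⟨v, T, hT, hTw⟩ := hθ.exists_form_eq hx (Pi.single κ 1)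
  obtain ⟨c, hc⟩ := h2 v T hT
  have hd : matrixDeriv (𝓡 m) (fun y => (γ y).val) x v (Sum.inl μ) (Sum.inr ()) = 0 :=
    mvfderiv_apply_eq_zero (hcol.mono fun y hy => hy μ) v
  have e := congrFun (congrFun hc (Sum.inl μ)) (Sum.inr ())
  have hcx := hcol.self_of_nhds
  simp only [Matrix.mul_apply, Matrix.add_apply, Matrix.smul_apply, Fintype.sum_sum_type, hcx, hd,
    hTw, Finset.univ_unique, Finset.sum_singleton, Pi.single_apply, smul_eq_mul, mul_zero,
    zero_mul, Finset.sum_const_zero, add_zero, zero_add, mul_ite, mul_one,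
    Finset.sum_ite_eq', Finset.mem_univ, if_true] at e
  have e' : (γ x).val (Sum.inl μ) (Sum.inl κ) =
      if μ = κ then (γ x).val (Sum.inr ()) (Sum.inr ()) else 0 := by
    simpa using e
  have hs : ∀ i j, (γ x * Matrix.GeneralLinearGroup.scalar (HIdx m) u).val i j =
      (γ x).val i j * u.val := by
    intro i j
    simp [Matrix.GeneralLinearGroup.scalar]
  rw [hs, hs, e']
  split_ifs <;> simp

/-- A transition map from a Cartan gauge to itself is trivial. -/
theorem LocalForm.IsTransitionAt.eq_one {k : N → PGL(HIdx m, ℝ)} (hθ : θ.IsCartanGauge)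
    (hx : x ∈ θ.dom) (H : ∀ᶠ y in 𝓝 x, θ.IsTransitionAt θ k y) : k x = 1 := by
  obtain ⟨γ, h1, h2⟩ := H.self_of_nhds.exists_lift
  have hiso : ∀ᶠ y in 𝓝 x, k y ∈ isotropyGroup m := H.mono fun y hy => hy.1
  have hcol : ∀ᶠ y in 𝓝 x, ∀ ρ, (γ y).val (Sum.inl ρ) (Sum.inr ()) = 0 := by
    filter_upwards [hiso, h1] with y hy hy1
    rw [← hy1] at hy
    exact mk_mem_isotropyGroup_iff.1 hy
  -- The block `A = s I` is needed on a neighbourhood, so that all diagonal entries of `γ` also have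
  -- the same derivative at `x`.
  have hsc : ∀ᶠ y in 𝓝 x, ∀ μ κ, (γ y).val (Sum.inl μ) (Sum.inl κ) =
      if μ = κ then (γ y).val (Sum.inr ()) (Sum.inr ()) else 0 := by
    filter_upwards [H, h1, eventually_eventually_nhds.2 hiso, θ.dom.isOpen.mem_nhds hx] with
      y hy hy1 hy2 hy3
    exact LocalForm.IsTransitionAt.isotropy_isScalar hθ hy3 hy2 hy hy1
  have hcx := hcol.self_of_nhds
  have hsx := hsc.self_of_nhds
  set s := (γ x).val (Sum.inr ()) (Sum.inr ()) with hs
  -- With `d = ds(v)`, the upper diagonal entries of the equation give `w_μ p_μ + d + c s = 0` and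
  -- the last one gives `p·w = d + c s`. Summing the former over `μ` yields `(m + 1)(d + c s) = 0`,
  -- so `p·w = 0`; as `w` is arbitrary, `p = 0` and `γ x` is scalar.
  have key : ∀ w : Fin m → ℝ, ∑ κ, (γ x).val (Sum.inr ()) (Sum.inl κ) * w κ = 0 := by
    intro w
    obtain ⟨v, T, hT, hTw⟩ := hθ.exists_form_eq hx w
    obtain ⟨c, hc⟩ := h2 v T hT
    set d := matrixDeriv (𝓡 m) (fun y => (γ y).val) x v (Sum.inr ()) (Sum.inr ()) with hd
    have hdiag : ∀ μ, matrixDeriv (𝓡 m) (fun y => (γ y).val) x v (Sum.inl μ) (Sum.inl μ) = d := by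
      intro μ
      have : (fun y => (γ y).val (Sum.inl μ) (Sum.inl μ)) =ᶠ[𝓝 x]
          fun y => (γ y).val (Sum.inr ()) (Sum.inr ()) := by
        filter_upwards [hsc] with y hy
        rw [hy, if_pos rfl]
      exact DFunLike.congr_fun this.mvfderiv_eq v
    have e0 := congrFun (congrFun hc (Sum.inr ())) (Sum.inr ())
    have e1 : ∀ μ, w μ * (γ x).val (Sum.inr ()) (Sum.inl μ) + (d + c * s) = 0 := by
      intro μ
      have e := congrFun (congrFun hc (Sum.inl μ)) (Sum.inl μ)
      simp only [Matrix.mul_apply, Matrix.add_apply, Matrix.smul_apply, Fintype.sum_sum_type, hcx,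
        hsx, hTw, hdiag, Finset.univ_unique, Finset.sum_singleton, smul_eq_mul,
        zero_mul, add_zero, mul_ite, ite_mul, mul_zero, PUnit.default_eq_unit,
        Finset.sum_ite_eq, Finset.sum_ite_eq', Finset.mem_univ, if_true] at e
      linarith
    simp only [Matrix.mul_apply, Matrix.add_apply, Matrix.smul_apply, Fintype.sum_sum_type, hcx,
      hTw, Finset.univ_unique, Finset.sum_singleton, smul_eq_mul, ← hs, ← hd,
      mul_zero, Finset.sum_const_zero, zero_add, PUnit.default_eq_unit] at e0
    have e2 : ∑ μ, w μ * (γ x).val (Sum.inr ()) (Sum.inl μ) + m * (d + c * s) = 0 := by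
      have := Finset.sum_eq_zero fun μ (_ : μ ∈ Finset.univ) => e1 μ
      rw [Finset.sum_add_distrib] at this
      simpa [mul_add] using this
    have e3 : ∑ κ, (γ x).val (Sum.inr ()) (Sum.inl κ) * w κ = d + c * s := by linarith
    have e4 : ∑ μ, w μ * (γ x).val (Sum.inr ()) (Sum.inl μ) = d + c * s := by
      rw [← e3]
      exact Finset.sum_congr rfl fun μ _ => mul_comm _ _
    rw [e4] at e2
    have e5 : ((m : ℝ) + 1) * (d + c * s) = 0 := by linarith
    rw [e3]
    exact (mul_eq_zero.1 e5).resolve_left (by positivity)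
  have hp : ∀ κ, (γ x).val (Sum.inr ()) (Sum.inl κ) = 0 := by
    intro κ
    simpa [Pi.single_apply] using key (Pi.single κ 1)
  have hγ : (γ x).val = s • (1 : Matrix (HIdx m) (HIdx m) ℝ) := by
    ext i j
    rcases i with i | i <;> rcases j with j | j
    · simp [hsx, Matrix.one_apply]
    · simp [hcx]
    · simp [hp]
    · simp [hs]
  rw [← h1.self_of_nhds, Matrix.ProjGenLinGroup.mk_eq_one, Subgroup.mem_center_iff]
  intro g
  ext1
  rw [Units.val_mul, Units.val_mul, hγ]
  simp

/-- The quotient of two transition maps is a transition map from `θ` to itself, hence trivial. -/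
theorem LocalForm.IsTransitionAt.unique (hθ : θ.IsCartanGauge) (hx : x ∈ θ.dom)
    (H : ∀ᶠ y in 𝓝 x, θ.IsTransitionAt θ' h y) (H' : ∀ᶠ y in 𝓝 x, θ.IsTransitionAt θ' h' y) :
    h x = h' x := by
  have h1 : h x * (h' x)⁻¹ = 1 := LocalForm.IsTransitionAt.eq_one
    (k := fun y => h y * (h' y)⁻¹) hθ hx (by
      filter_upwards [H, H'] with y hy hy' using hy.mul hy'.inv)
  exact mul_inv_eq_one.1 h1

/-- Transitivity of compatibility through a cover: going back along `η` and forth again gives a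
transition map over each `η.dom`, and uniqueness makes these agree on overlaps. -/
theorem LocalForm.Compatible.of_cover {A : Set (LocalForm m N)}
    (hA : ∀ x : N, ∃ η ∈ A, x ∈ η.dom) (hθ : θ.IsCartanGauge)
    (h1 : ∀ η ∈ A, η.Compatible θ) (h2 : ∀ η ∈ A, η.Compatible θ') : θ.Compatible θ' := by
  choose η hη hηx using hA
  choose f hf using fun x => h1 (η x) (hη x)
  choose f' hf' using fun x => h2 (η x) (hη x)
  have trans : ∀ x y, y ∈ (η x).dom → y ∈ θ.dom → y ∈ θ'.dom →
      θ.IsTransitionAt θ' (fun z => (f x z)⁻¹ * f' x z) y := fun x y h3 h4 h5 =>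
    LocalForm.IsTransitionAt.mul (LocalForm.IsTransitionAt.inv (hf x y ⟨h3, h4⟩))
      (hf' x y ⟨h3, h5⟩)
  -- At each point the witness uses the gauge chosen for that point, so its smoothness is not
  -- apparent; near `x` uniqueness identifies it with the map built from the single gauge `η x`.
  refine ⟨fun x => (f x x)⁻¹ * f' x x, fun x hx => ?_⟩
  have hev : ∀ {y : N}, y ∈ θ.dom → y ∈ θ'.dom → ∀ z, y ∈ (η z).dom →
      ∀ᶠ w in 𝓝 y, θ.IsTransitionAt θ' (fun u => (f z u)⁻¹ * f' z u) w := by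
    intro y hy hy' z hz
    filter_upwards [θ.dom.isOpen.mem_nhds hy, θ'.dom.isOpen.mem_nhds hy',
      (η z).dom.isOpen.mem_nhds hz] with w k1 k2 k3 using trans z w k3 k1 k2
  change θ.IsTransitionAt θ' (fun x => (f x x)⁻¹ * f' x x) x
  refine LocalForm.IsTransitionAt.congr (trans x x (hηx x) hx.1 hx.2) ?_
  filter_upwards [θ.dom.isOpen.mem_nhds hx.1, θ'.dom.isOpen.mem_nhds hx.2,
    (η x).dom.isOpen.mem_nhds (hηx x)] with y k1 k2 k3
  exact LocalForm.IsTransitionAt.unique (h := fun u => (f y u)⁻¹ * f' y u)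
    (h' := fun u => (f x u)⁻¹ * f' x u) hθ k1 (hev k1 k2 y (hηx y)) (hev k1 k2 x k3)

/-- A Cartan atlas is contained in exactly one maximal Cartan atlas. -/
theorem IsCartanAtlas.existsUnique_maximal {A : Set (LocalForm m N)} (hA : IsCartanAtlas A) :
    ∃! G : ProjectiveCartanGeometry m N, A ⊆ G.gauges := by
  -- Every Cartan atlas containing `A` lies in `B`; once `B` is itself an atlas, existence and
  -- uniqueness both follow.
  let B : Set (LocalForm m N) := {θ | θ.IsCartanGauge ∧ ∀ η ∈ A, η.Compatible θ}
  have hAB : A ⊆ B := fun θ hθ => ⟨hA.gauge θ hθ, fun η hη => hA.compatible η hη θ hθ⟩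
  have hB : IsCartanAtlas B :=
    { gauge := fun θ hθ => hθ.1
      cover := fun x => by
        obtain ⟨θ, hθ, hx⟩ := hA.cover x
        exact ⟨θ, hAB hθ, hx⟩
      compatible := fun θ hθ θ' hθ' => LocalForm.Compatible.of_cover hA.cover hθ.1 hθ.2 hθ'.2 }
  have hsub : ∀ C : Set (LocalForm m N), IsCartanAtlas C → A ⊆ C → C ⊆ B := fun C hC hAC θ hθ =>
    ⟨hC.gauge θ hθ, fun η hη => hC.compatible η (hAC hη) θ hθ⟩
  refine ⟨⟨B, hB, fun C hC hBC => (hsub C hC (hAB.trans hBC)).antisymm hBC⟩, hAB, ?_⟩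
  rintro ⟨C, hC, hmax⟩ hAC
  have h1 : B = C := hmax B hB (hsub C hC hAC)
  subst h1
  rfl

end CartanAtlas

/-! ### Smooth functions on the tangent bundle built from functions on the base. -/

section TangentBundleFunctions

variable {E : Type*} [NormedAddCommGroup E] [NormedSpace ℝ E]
  {H : Type*} [TopologicalSpace H] {I : ModelWithCorners ℝ E H}
  {N : Type*} [TopologicalSpace N] [ChartedSpace H N] [IsManifold I ∞ N]

/-- The differential of a smooth function is a smooth function on the tangent bundle. -/
theorem SmoothFnAt.contMDiffAt_mvfderiv {f : N → ℝ} {v : TangentBundle I N}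
    (hf : SmoothFnAt I f v.proj) :
    ContMDiffAt I.tangent 𝓘(ℝ, ℝ) ∞
      (fun w : TangentBundle I N => mvfderiv I f w.proj w.snd) v := by
  have h3 : ContMDiffAt I.tangent 𝓘(ℝ, ℝ).tangent ∞ (tangentMap I 𝓘(ℝ, ℝ) f) v := by
    obtain ⟨U, hU, hUo, hyU⟩ := eventually_nhds_iff.1 hf
    have hfU : ContMDiffOn I 𝓘(ℝ, ℝ) ∞ f U := fun z hz => (hU z hz).contMDiffWithinAt
    have h4 := hfU.contMDiffOn_tangentMapWithin (m := ∞) (by simp) hUo.uniqueMDiffOn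
    have h5 : (TotalSpace.proj ⁻¹' U : Set (TangentBundle I N)) ∈ 𝓝 v :=
      (hUo.preimage (FiberBundle.continuous_proj E (TangentSpace I))).mem_nhds hyU
    refine (h4.contMDiffAt h5).congr_of_eventuallyEq ?_
    filter_upwards [h5] with z hz
    rw [tangentMapWithin_eq_tangentMap (hUo.uniqueMDiffWithinAt hz)
      ((hU _ hz).mdifferentiableAt (by simp))]
  exact (contMDiff_snd_tangentBundle_modelSpace ℝ 𝓘(ℝ, ℝ)).contMDiffAt.comp v h3

theorem SmoothFnAt.contMDiffAt_proj {f : N → ℝ} {v : TangentBundle I N}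
    (hf : SmoothFnAt I f v.proj) :
    ContMDiffAt I.tangent 𝓘(ℝ, ℝ) ∞ (fun w : TangentBundle I N => f w.proj) v :=
  ContMDiffAt.comp v hf.contMDiffAt
    ((contMDiff_proj (TangentSpace I : N → Type _)).contMDiffAt (x := v))

end TangentBundleFunctions

/-! ### The reduced boundary gauges and their gauge transformations. -/

section BoundaryForm

variable {m : ℕ} {M : Type*} [TopologicalSpace M] [ChartedSpace (EuclideanHalfSpace (m + 1)) M]
  [IsManifold (𝓡∂ (m + 1)) ∞ M] {e e' e'' : OpenPartialHomeomorph M (EuclideanHalfSpace (m + 1))}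

theorem contMDiffAt_coordForm_boundaryDeriv (he : e ∈ IsManifold.maximalAtlas (𝓡∂ (m + 1)) ∞ M)
    {v : TangentBundle (𝓡 m) (Bdry m M)} (hx : v.proj.val ∈ e.source) (i : Fin (m + 1)) :
    ContMDiffAt (𝓡 m).tangent 𝓘(ℝ, ℝ) ∞ (fun w : TangentBundle (𝓡 m) (Bdry m M) =>
      coordForm e i w.proj.val (boundaryDeriv w.proj w.snd)) v := by
  refine ((smoothFnAt_coord he hx i).comp_boundary_val.contMDiffAt_mvfderiv).congr_of_eventuallyEq ?_
  have h : ∀ᶠ w : TangentBundle (𝓡 m) (Bdry m M) in 𝓝 v, w.proj.val ∈ e.source :=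
    (FiberBundle.continuous_proj _ (TangentSpace (𝓡 m))).continuousAt.eventually
      (eventually_mem_source hx)
  filter_upwards [h] with w hw
  rw [coordForm_eq_mvfderiv he hw, mvfderiv_boundaryDeriv (smoothFnAt_coord he hw i)]

namespace TorsionFreeConnection

variable (α : TorsionFreeConnection m M)

/-- Expand the vector in the coordinate frame: `α^i_j(v) = ∑ dx^k(v) α^i_j(∂_k)` separates the fibre
dependence from smooth functions on the base. -/
theorem contMDiffAt_connForm_boundaryDeriv [T2Space M]
    (he : e ∈ IsManifold.maximalAtlas (𝓡∂ (m + 1)) ∞ M)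
    {v : TangentBundle (𝓡 m) (Bdry m M)} (hx : v.proj.val ∈ e.source) (i j : Fin (m + 1)) :
    ContMDiffAt (𝓡 m).tangent 𝓘(ℝ, ℝ) ∞ (fun w : TangentBundle (𝓡 m) (Bdry m M) =>
      α.connForm e i j w.proj.val (boundaryDeriv w.proj w.snd)) v := by
  have h1 : ∀ k, ContMDiffAt (𝓡 m).tangent 𝓘(ℝ, ℝ) ∞ (fun w : TangentBundle (𝓡 m) (Bdry m M) =>
      coordForm e k w.proj.val (boundaryDeriv w.proj w.snd) *
        α.connForm e i j w.proj.val (coordField e k w.proj.val)) v := fun k =>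
    (contMDiffAt_coordForm_boundaryDeriv he hx k).mul
      ((α.smoothFnAt_connForm he hx i j
        (smoothFieldAt_coordField he hx k)).comp_boundary_val.contMDiffAt_proj)
  refine (contMDiffAt_finsetSum (t := Finset.univ) fun k _ => h1 k).congr_of_eventuallyEq ?_
  have h : ∀ᶠ w : TangentBundle (𝓡 m) (Bdry m M) in 𝓝 v, w.proj.val ∈ e.source :=
    (FiberBundle.continuous_proj _ (TangentSpace (𝓡 m))).continuousAt.eventually
      (eventually_mem_source hx)
  filter_upwards [h] with w hw
  conv_lhs => rw [← sum_coordForm_smul_coordField he hw (boundaryDeriv w.proj w.snd)]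
  simp only [map_sum, map_smul, smul_eq_mul]

/-- The lower right block of the pullback of the gauge to the boundary, normalised modulo scalar
matrices. -/
noncomputable def boundaryMatrix (e : OpenPartialHomeomorph M (EuclideanHalfSpace (m + 1)))
    (x : Bdry m M) (v : TangentSpace (𝓡 m) x) : Matrix (HIdx m) (HIdx m) ℝ :=
  Matrix.fromBlocks
    (Matrix.of fun μ ν => α.connForm e μ.succ ν.succ x.val (boundaryDeriv x v))
    (Matrix.of fun μ _ => coordForm e μ.succ x.val (boundaryDeriv x v))
    (Matrix.of fun _ ν =>
      -∑ κ : Fin m, α.schouten e κ.succ ν.succ x.val * coordForm e κ.succ x.val (boundaryDeriv x v))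
    0

theorem pullbackGauge_mem_gTilde (he : e ∈ IsManifold.maximalAtlas (𝓡∂ (m + 1)) ∞ M)
    {x : Bdry m M} (hx : x.val ∈ e.source) (v : TangentSpace (𝓡 m) x)
    (h : ∀ μ : Fin m, α.connForm e 0 μ.succ x.val (boundaryDeriv x v) = 0) :
    α.pullbackGauge e x v ∈ gTilde m := by
  rintro (j | j) hj
  · obtain ⟨μ, rfl⟩ := Fin.exists_succ_eq.2 fun h0 => hj (congrArg Sum.inl h0)
    change α.connForm e 0 μ.succ x.val (boundaryDeriv x v) - (if (0 : Fin (m + 1)) = μ.succ then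
      1 / ((m : ℝ) + 2) * ∑ l, α.connForm e l l x.val (boundaryDeriv x v) else 0) = 0
    rw [h, if_neg (Fin.succ_ne_zero μ).symm, sub_zero]
  · exact coordForm_zero_boundaryDeriv he hx v

/-- The trace terms occur equally in every diagonal entry, so they vanish in `𝔭𝔤𝔩`; the `dr` term of
the Schouten row vanishes on tangent vectors. -/
theorem boundaryForm_form_eq (he : e ∈ IsManifold.maximalAtlas (𝓡∂ (m + 1)) ∞ M)
    {x : Bdry m M} (hx : x.val ∈ e.source)
    (h : ∀ v, ∀ μ : Fin m, α.connForm e 0 μ.succ x.val (boundaryDeriv x v) = 0)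
    (v : TangentSpace (𝓡 m) x) :
    (α.boundaryForm e).form x v = Pgl.mk (α.boundaryMatrix e x v) := by
  have h1 : ∀ v, α.pullbackGauge e x v ∈ (gTilde m).toSubmodule := fun v =>
    α.pullbackGauge_mem_gTilde he hx v (h v)
  have h2 : (α.boundaryForm e).form x v = Pgl.mk ((α.pullbackGauge e x v).submatrix
      (hyperplaneIdx m) (hyperplaneIdx m)) := by
    simp only [boundaryForm]
    rw [dif_pos h1]
    rfl
  rw [h2, Pgl.mk_eq_mk_iff]
  refine ⟨-(1 / ((m : ℝ) + 2) * ∑ l, α.connForm e l l x.val (boundaryDeriv x v)), ?_⟩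
  ext i j
  rcases i with i | i <;> rcases j with j | j
  · change α.connForm e i.succ j.succ x.val (boundaryDeriv x v) - (if i.succ = j.succ then
      1 / ((m : ℝ) + 2) * ∑ l, α.connForm e l l x.val (boundaryDeriv x v) else 0) = _
    simp [boundaryMatrix, Matrix.one_apply, sub_eq_add_neg, Fin.succ_inj]
  · change coordForm e i.succ x.val (boundaryDeriv x v) = _
    simp [boundaryMatrix]
  · change -∑ k, α.schouten e k j.succ x.val * coordForm e k x.val (boundaryDeriv x v) = _
    rw [Fin.sum_univ_succ, coordForm_zero_boundaryDeriv he hx]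
    simp [boundaryMatrix]
  · change -(1 / ((m : ℝ) + 2) * ∑ l, α.connForm e l l x.val (boundaryDeriv x v)) = _
    simp [boundaryMatrix]

theorem contMDiffAt_boundaryMatrix [T2Space M] (he : e ∈ IsManifold.maximalAtlas (𝓡∂ (m + 1)) ∞ M)
    {v : TangentBundle (𝓡 m) (Bdry m M)} (hx : v.proj.val ∈ e.source) (a b : HIdx m) :
    ContMDiffAt (𝓡 m).tangent 𝓘(ℝ, ℝ) ∞ (fun w : TangentBundle (𝓡 m) (Bdry m M) =>
      α.boundaryMatrix e w.proj w.snd a b) v := by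
  rcases a with a | a <;> rcases b with b | b
  · exact α.contMDiffAt_connForm_boundaryDeriv he hx _ _
  · exact contMDiffAt_coordForm_boundaryDeriv he hx _
  · exact (contMDiffAt_finsetSum (t := Finset.univ) fun k _ =>
      ((α.smoothFnAt_schouten he hx _ _).comp_boundary_val.contMDiffAt_proj).mul
        (contMDiffAt_coordForm_boundaryDeriv he hx _)).neg
  · exact contMDiffAt_const

theorem boundaryForm_isCartanGauge [T2Space M] (he : e ∈ IsManifold.maximalAtlas (𝓡∂ (m + 1)) ∞ M)
    (h : ∀ x : Bdry m M, x.val ∈ e.source → ∀ v, ∀ μ : Fin m,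
      α.connForm e 0 μ.succ x.val (boundaryDeriv x v) = 0) :
    (α.boundaryForm e).IsCartanGauge where
  smooth l v hv := by
    refine ContMDiffAt.contMDiffWithinAt ?_
    have hv' : v.proj.val ∈ e.source := hv
    -- Expanding in elementary matrices reduces a functional on `𝔭𝔤𝔩` to a constant-coefficient
    -- combination of the matrix entries.
    have h1 : ContMDiffAt (𝓡 m).tangent 𝓘(ℝ, ℝ) ∞ (fun w : TangentBundle (𝓡 m) (Bdry m M) =>
        ∑ a, ∑ b, α.boundaryMatrix e w.proj w.snd a b * l (Pgl.mk (Matrix.single a b 1))) v :=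
      contMDiffAt_finsetSum fun a _ => contMDiffAt_finsetSum fun b _ =>
        (α.contMDiffAt_boundaryMatrix he hv' a b).mul contMDiffAt_const
    refine h1.congr_of_eventuallyEq ?_
    have h2 : ∀ᶠ w : TangentBundle (𝓡 m) (Bdry m M) in 𝓝 v, w.proj.val ∈ e.source :=
      (FiberBundle.continuous_proj _ (TangentSpace (𝓡 m))).continuousAt.eventually
        (eventually_mem_source hv')
    filter_upwards [h2] with w hw
    rw [α.boundaryForm_form_eq he hw (h _ hw)]
    conv_lhs => rw [Matrix.matrix_eq_sum_single (α.boundaryMatrix e w.proj w.snd)]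
    simp only [map_sum]
    refine Finset.sum_congr rfl fun a _ => Finset.sum_congr rfl fun b _ => ?_
    rw [← smul_eq_mul, ← map_smul, ← map_smul, Matrix.smul_single, smul_eq_mul, mul_one]
  regular x hx := by
    have hx' : x.val ∈ e.source := hx
    have hb := bijective_coordForm_succ_boundaryDeriv he hx'
    -- Adding a scalar matrix does not change the upper part of the last column, so membership in
    -- `𝔥` can be tested on any representative.
    have hcol : ∀ (X : Matrix (HIdx m) (HIdx m) ℝ), Pgl.mk X ∈ isotropyAlgebra m →
        ∀ μ, X (Sum.inl μ) (Sum.inr ()) = 0 := by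
      rintro X ⟨Y, hY, hYX⟩ μ
      obtain ⟨c, rfl⟩ := Pgl.mk_eq_mk_iff.1 hYX.symm
      simpa using hY μ
    constructor
    · rw [injective_iff_map_eq_zero]
      intro v hv
      have h1 : (α.boundaryForm e).form x v ∈ isotropyAlgebra m :=
        (Submodule.Quotient.mk_eq_zero _).1 hv
      rw [α.boundaryForm_form_eq he hx' (h x hx')] at h1
      refine hb.1 (funext fun μ => ?_)
      simp only [map_zero]
      exact hcol _ h1 μ
    · intro Z
      obtain ⟨Z, rfl⟩ := Submodule.mkQ_surjective _ Z
      obtain ⟨X, rfl⟩ := Pgl.mk_surjective Z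
      obtain ⟨v, hv⟩ := hb.2 fun μ => X (Sum.inl μ) (Sum.inr ())
      refine ⟨v, (Submodule.Quotient.eq _).2 ?_⟩
      rw [α.boundaryForm_form_eq he hx' (h x hx'), ← map_sub]
      refine ⟨_, fun μ => ?_, rfl⟩
      exact sub_eq_zero.2 (congrFun hv μ)

end TorsionFreeConnection

/-- The tangential block of the Jacobian, as a matrix acting on homogeneous coordinates. -/
noncomputable def boundaryJacobian (e e' : OpenPartialHomeomorph M (EuclideanHalfSpace (m + 1)))
    (x : Bdry m M) : Matrix (HIdx m) (HIdx m) ℝ :=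
  Matrix.fromBlocks (Matrix.of fun μ ν : Fin m => chartJacobian e e' μ.succ ν.succ x.val) 0 0 1

theorem boundaryJacobian_mul (he' : e' ∈ IsManifold.maximalAtlas (𝓡∂ (m + 1)) ∞ M)
    (he'' : e'' ∈ IsManifold.maximalAtlas (𝓡∂ (m + 1)) ∞ M) {x : Bdry m M}
    (hx' : x.val ∈ e'.source) (hx'' : x.val ∈ e''.source) :
    boundaryJacobian e e' x * boundaryJacobian e' e'' x = boundaryJacobian e e'' x := by
  simp only [boundaryJacobian, Matrix.fromBlocks_multiply, add_zero, zero_add, mul_one,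
    Matrix.mul_zero, Matrix.zero_mul]
  congr 1
  ext μ ν
  exact sum_chartJacobian_succ_mul he' he'' hx' hx'' μ ν

theorem boundaryJacobian_self (he : e ∈ IsManifold.maximalAtlas (𝓡∂ (m + 1)) ∞ M) {x : Bdry m M}
    (hx : x.val ∈ e.source) : boundaryJacobian e e x = 1 := by
  rw [boundaryJacobian, ← Matrix.fromBlocks_one]
  congr 1
  ext μ ν
  simp [chartJacobian_self he hx, Matrix.one_apply]

open scoped Classical in
/-- The Jacobian matrix as an invertible matrix, extended by `1` off the overlap of the charts. -/
noncomputable def boundaryJacobianGL (he : e ∈ IsManifold.maximalAtlas (𝓡∂ (m + 1)) ∞ M)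
    (he' : e' ∈ IsManifold.maximalAtlas (𝓡∂ (m + 1)) ∞ M) (x : Bdry m M) : GL (HIdx m) ℝ :=
  if h : x.val ∈ e.source ∧ x.val ∈ e'.source then
    ⟨boundaryJacobian e e' x, boundaryJacobian e' e x,
      (boundaryJacobian_mul he' he h.2 h.1).trans (boundaryJacobian_self he h.1),
      (boundaryJacobian_mul he he' h.1 h.2).trans (boundaryJacobian_self he' h.2)⟩
  else 1

theorem boundaryJacobianGL_val (he : e ∈ IsManifold.maximalAtlas (𝓡∂ (m + 1)) ∞ M)
    (he' : e' ∈ IsManifold.maximalAtlas (𝓡∂ (m + 1)) ∞ M) {x : Bdry m M}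
    (hx : x.val ∈ e.source) (hx' : x.val ∈ e'.source) :
    (boundaryJacobianGL he he' x).val = boundaryJacobian e e' x := by
  rw [boundaryJacobianGL, dif_pos ⟨hx, hx'⟩]

theorem boundaryJacobianGL_inv_val (he : e ∈ IsManifold.maximalAtlas (𝓡∂ (m + 1)) ∞ M)
    (he' : e' ∈ IsManifold.maximalAtlas (𝓡∂ (m + 1)) ∞ M) {x : Bdry m M}
    (hx : x.val ∈ e.source) (hx' : x.val ∈ e'.source) :
    (boundaryJacobianGL he he' x)⁻¹.val = boundaryJacobian e' e x := by
  rw [boundaryJacobianGL, dif_pos ⟨hx, hx'⟩]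
  rfl

theorem boundaryJacobianGL_mul (he : e ∈ IsManifold.maximalAtlas (𝓡∂ (m + 1)) ∞ M)
    (he' : e' ∈ IsManifold.maximalAtlas (𝓡∂ (m + 1)) ∞ M)
    (he'' : e'' ∈ IsManifold.maximalAtlas (𝓡∂ (m + 1)) ∞ M) {x : Bdry m M}
    (hx : x.val ∈ e.source) (hx' : x.val ∈ e'.source) (hx'' : x.val ∈ e''.source) :
    boundaryJacobianGL he he'' x = boundaryJacobianGL he he' x * boundaryJacobianGL he' he'' x := by
  ext1
  rw [Units.val_mul, boundaryJacobianGL_val he he'' hx hx'', boundaryJacobianGL_val he he' hx hx',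
    boundaryJacobianGL_val he' he'' hx' hx'', boundaryJacobian_mul he' he'' hx' hx'']

theorem smoothFnAt_boundaryJacobian (he : e ∈ IsManifold.maximalAtlas (𝓡∂ (m + 1)) ∞ M)
    (he' : e' ∈ IsManifold.maximalAtlas (𝓡∂ (m + 1)) ∞ M) {x : Bdry m M}
    (hx : x.val ∈ e.source) (hx' : x.val ∈ e'.source) (a b : HIdx m) :
    SmoothFnAt (𝓡 m) (fun y => boundaryJacobian e e' y a b) x := by
  rcases a with a | a <;> rcases b with b | b
  · exact (smoothFnAt_chartJacobian he hx he' hx' a.succ b.succ).comp_boundary_val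
  · exact smoothFnAt_const 0
  · exact smoothFnAt_const 0
  · exact smoothFnAt_const _

theorem matrixDeriv_boundaryJacobian (x : Bdry m M) (v : TangentSpace (𝓡 m) x) :
    matrixDeriv (𝓡 m) (boundaryJacobian e e') x v = Matrix.fromBlocks (Matrix.of fun μ ν : Fin m =>
      mvfderiv (𝓡 m) (fun y : Bdry m M => chartJacobian e e' μ.succ ν.succ y.val) x v) 0 0 0 := by
  ext a b
  rcases a with a | a <;> rcases b with b | b
  · rfl
  · exact mvfderiv_apply_eq_zero (Filter.Eventually.of_forall fun _ => rfl) v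
  · exact mvfderiv_apply_eq_zero (Filter.Eventually.of_forall fun _ => rfl) v
  · have h : (fun y : Bdry m M => boundaryJacobian e e' y (Sum.inr a) (Sum.inr b)) = fun _ => 1 := by
      funext y
      simp [boundaryJacobian]
    simp [matrixDeriv, h, mvfderiv_const]

namespace TorsionFreeConnection

variable (α : TorsionFreeConnection m M)

/-- The boundary matrices of two charts differ by a gauge transformation. -/
theorem boundaryMatrix_change [T2Space M] (he : e ∈ IsManifold.maximalAtlas (𝓡∂ (m + 1)) ∞ M)
    (he' : e' ∈ IsManifold.maximalAtlas (𝓡∂ (m + 1)) ∞ M) {x : Bdry m M} (hx : x.val ∈ e.source)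
    (hx' : x.val ∈ e'.source) (v : TangentSpace (𝓡 m) x)
    (h : ∀ μ : Fin m, α.connForm e 0 μ.succ x.val (boundaryDeriv x v) = 0) :
    α.boundaryMatrix e' x v =
      boundaryJacobian e' e x * matrixDeriv (𝓡 m) (boundaryJacobian e e') x v +
        boundaryJacobian e' e x * α.boundaryMatrix e x v * boundaryJacobian e e' x := by
  rw [mul_assoc, ← mul_add, matrixDeriv_boundaryJacobian, boundaryMatrix, boundaryMatrix,
    boundaryJacobian, boundaryJacobian]
  simp only [Matrix.fromBlocks_multiply, Matrix.fromBlocks_add, Matrix.mul_zero, Matrix.zero_mul,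
    Matrix.mul_one, Matrix.one_mul, add_zero, zero_add]
  congr 1
  · ext μ ν
    exact α.connForm_succ_boundaryDeriv_change he he' hx hx' v h μ ν
  · ext μ j
    exact coordForm_succ_boundaryDeriv_change he hx μ v
  · ext j ν
    -- Tensoriality gives `P'` two Jacobian factors; writing `dy` in terms of `dy'` on the other
    -- side produces the same triple sums, up to reordering.
    simp only [Matrix.of_apply, Matrix.mul_apply, neg_mul, Finset.sum_neg_distrib, neg_inj]
    simp only [α.schouten_succ_change he he' hx hx',
      fun κ : Fin m => coordForm_succ_boundaryDeriv_change (e' := e) he' hx' κ v,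
      Finset.sum_mul, Finset.mul_sum]
    rw [Finset.sum_congr rfl fun κ _ => Finset.sum_comm, Finset.sum_comm]
    refine Finset.sum_congr rfl fun l _ => ?_
    rw [Finset.sum_comm]
    exact Finset.sum_congr rfl fun a _ => Finset.sum_congr rfl fun κ _ => by ring

theorem boundaryForm_isTransition [T2Space M] (he : e ∈ IsManifold.maximalAtlas (𝓡∂ (m + 1)) ∞ M)
    (he' : e' ∈ IsManifold.maximalAtlas (𝓡∂ (m + 1)) ∞ M)
    (h : ∀ x : Bdry m M, x.val ∈ e.source → ∀ v, ∀ μ : Fin m,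
      α.connForm e 0 μ.succ x.val (boundaryDeriv x v) = 0)
    (h' : ∀ x : Bdry m M, x.val ∈ e'.source → ∀ v, ∀ μ : Fin m,
      α.connForm e' 0 μ.succ x.val (boundaryDeriv x v) = 0) :
    (α.boundaryForm e).IsTransition (α.boundaryForm e')
      fun x => Matrix.ProjGenLinGroup.mk (boundaryJacobianGL he he' x) := by
  rintro x ⟨hx : x.val ∈ e.source, hx' : x.val ∈ e'.source⟩
  -- Taking `D` to be the difference `θ' - Ad(h⁻¹) θ` makes the gauge equation automatic; the
  -- content moves to showing that `D` is the Maurer–Cartan pullback.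
  refine ⟨mk_mem_isotropyGroup_iff.2 fun μ => ?_, (α.boundaryForm e').form x -
    adPGL (HIdx m) (Matrix.ProjGenLinGroup.mk (boundaryJacobianGL he he' x))⁻¹ ∘ₗ
      (α.boundaryForm e).form x, ⟨{y | y.val ∈ e.source ∧ y.val ∈ e'.source},
        (eventually_mem_source hx).and (eventually_mem_source hx'), boundaryJacobianGL he he',
        fun a b y hy => ?_, fun _ _ => rfl, fun v => ?_⟩, (sub_add_cancel _ _).symm⟩
  · rw [boundaryJacobianGL_val he he' hx hx']
    rfl
  · refine ContMDiffAt.contMDiffWithinAt ?_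
    refine (smoothFnAt_boundaryJacobian he he' hy.1 hy.2 a b).contMDiffAt.congr_of_eventuallyEq ?_
    filter_upwards [eventually_mem_source hy.1, eventually_mem_source hy.2] with z hz hz'
    rw [boundaryJacobianGL_val he he' hz hz']
  · change (α.boundaryForm e').form x v - adPGL (HIdx m)
      (Matrix.ProjGenLinGroup.mk (boundaryJacobianGL he he' x))⁻¹ ((α.boundaryForm e).form x v) =
      Pgl.mk ((boundaryJacobianGL he he' x)⁻¹.val *
        matrixDeriv (𝓡 m) (fun y => (boundaryJacobianGL he he' y).val) x v)
    have hG : (fun y => (boundaryJacobianGL he he' y).val) =ᶠ[𝓝 x] boundaryJacobian e e' := by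
      filter_upwards [eventually_mem_source hx, eventually_mem_source hx'] with z hz hz'
      exact boundaryJacobianGL_val he he' hz hz'
    rw [α.boundaryForm_form_eq he hx (h x hx), α.boundaryForm_form_eq he' hx' (h' x hx'),
      ← map_inv, adPGL_mk_mk, inv_inv, boundaryJacobianGL_val he he' hx hx',
      boundaryJacobianGL_inv_val he he' hx hx', matrixDeriv_congr hG, ← map_sub,
      α.boundaryMatrix_change he he' hx hx' v (h x hx v), add_sub_cancel_right]

end TorsionFreeConnection

end BoundaryForm

/-! ### Assembly of the Cartan atlas on the boundary. -/

theorem mainTheorem6 (m : ℕ) (hm : 1 ≤ m)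
    {M : Type*} [TopologicalSpace M] [T2Space M] [SecondCountableTopology M]
    [ChartedSpace (EuclideanHalfSpace (m + 1)) M] [IsManifold (𝓡∂ (m + 1)) ∞ M]
    (P : ProjectiveStructure m M) (hP : P.IsNonRigid)
    (α : TorsionFreeConnection m M) (hα : (⟦α⟧ : ProjectiveStructure m M) = P)
    {ι : Type*} (e : ι → OpenPartialHomeomorph M (EuclideanHalfSpace (m + 1)))
    (he : ∀ i, e i ∈ IsManifold.maximalAtlas (𝓡∂ (m + 1)) ∞ M)
    (hcover : (𝓡∂ (m + 1)).boundary M ⊆ ⋃ i, (e i).source) :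
    (∀ i, ∀ x : Bdry m M, x.val ∈ (e i).source →
      ∀ v : TangentSpace (𝓡 m) x, α.pullbackGauge (e i) x v ∈ gTilde m) ∧
    IsCartanAtlas (Set.range fun i => α.boundaryForm (e i)) ∧
    (∃ h : ι → ι → Bdry m M → PGL(HIdx m, ℝ),
      (∀ i j, (α.boundaryForm (e i)).IsTransition (α.boundaryForm (e j)) (h i j)) ∧
      ∀ i j k, ∀ x : Bdry m M, x.val ∈ (e i).source → x.val ∈ (e j).source →
        x.val ∈ (e k).source → h i k x = h i j x * h j k x) ∧
    ∃! G : ProjectiveCartanGeometry m (Bdry m M), ∀ i, α.boundaryForm (e i) ∈ G.gauges := by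
  -- Non-rigidity enters only here; everything afterwards uses just the vanishing of `α^0_μ` on
  -- tangent vectors.
  have hzero : ∀ i, ∀ x : Bdry m M, x.val ∈ (e i).source → ∀ v, ∀ μ : Fin m,
      α.connForm (e i) 0 μ.succ x.val (boundaryDeriv x v) = 0 := fun i x hx v μ =>
    α.connForm_zero_succ_boundaryDeriv hP hα (he i) hx v μ
  have htrans := fun i j =>
    α.boundaryForm_isTransition (he i) (he j) (hzero i) (hzero j)
  have hatlas : IsCartanAtlas (Set.range fun i => α.boundaryForm (e i)) :=
    { gauge := by
        rintro _ ⟨i, rfl⟩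
        exact α.boundaryForm_isCartanGauge (he i) (hzero i)
      cover := fun x => by
        obtain ⟨i, hi⟩ := mem_iUnion.1 (hcover x.property)
        exact ⟨_, ⟨i, rfl⟩, hi⟩
      compatible := by
        rintro _ ⟨i, rfl⟩ _ ⟨j, rfl⟩
        exact ⟨_, htrans i j⟩ }
  refine ⟨fun i x hx v => α.pullbackGauge_mem_gTilde (he i) hx v (hzero i x hx v), hatlas,
    ⟨fun i j x => Matrix.ProjGenLinGroup.mk (boundaryJacobianGL (he i) (he j) x), htrans,
      fun i j k x hi hj hk => ?_⟩, ?_⟩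
  · rw [← map_mul, ← boundaryJacobianGL_mul (he i) (he j) (he k) hi hj hk]
  · simpa only [range_subset_iff] using hatlas.existsUnique_maximal
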